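/- **Codes.** Let $m\ge 2$, $n=2^m-1$, $1\le k\le 2^{m-1}-1$, and let $\alpha$ be a primitive element of $\mathbb F_{2^m}$. Let $C_{\rm RS}$ be the Reed–Solomon code of length $n$ with generator polynomial $\prod_{i=0}^{n-k-1}(x-\alpha^i)$, let $B=\mathcal B(C_{\rm RS})$ be its binary expansion with respect to a self-dual basis of $\mathbb F_{2^m}$ over $\mathbb F_2$, and let $C_1=\omega B+\bar\omega B\subseteq(\mathbb F_4^m)^n$ (the quantum RS code $Q_1$). Let $Q_2$ be an inner $[[n_2,m]]$ stabilizer code given by $n_2-m$ generators of a self-orthogonal additive code $C_2\subseteq\mathbb F_4^{n_2}$ of size $2^{n_2-m}$ such that every vector of $C_2^\perp\setminus C_2$ (trace-dual) has weight at least $\delta_2n_2$. Let $\rho:\mathbb F_4^m\to C_2^\perp/C_2$ be additive and inner-product-preserving. The concatenated code $Q$ has $N=nn_2$ qubits and stabilizer $S=\rho(C_1)=\{(\rho(v_i)+u_i)_i : v\in C_1,\ u_i\in C_2\}$. Put $\delta=\delta_2\,k/n$. **Decoder.** *Inner stage*: for each inner block, measure the generators of $C_2$, find by exhaustive search over $\mathbb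 F_4^{n_2}$ a vector of least weight with the measured syndrome, and apply the corresponding Pauli operator. *Outer stage*: measure the syndromes of both CSS halves of $Q_1$ (on the encoded blocks), decode each half by the Berlekamp–Massey algorithm (with root search and Forney's formula), and apply the encoded correction. The table version of the decoder differs only in that the results of the exhaustive search for all $2^{n_2-m}$ syndromes are tabulated once for the code and looked up. **Cost model.** Operations on bits, counters, and symbols of $\mathbb F_4$ cost one step, an operation in $\mathbb F_{2^m}$ costs $m^2$ steps, a one-qubit Pauli gate costs one step, and measuring a Pauli operator of weight $w$ costs $w+4$ steps. **Claim.** 1. Every vector of $S^\perp\setminus S$ has weight at least $\delta N$, so $\delta$ is a lower bound on the relative minimum distance of $Q$. 2. Both versions of the decoder correct up to $\delta N/4$ errors: for every choice of signs of the stabilizer, every state $\psi$ of $Q$, and every error operator $E$ in the span of the Pauli operators of weight at most $\delta N/4$, every measurement branch of the decoder on $E\psi$ ends in a scalar multiple of $\psi$. 3. There is an absolute constant $C$ such that, in every branch and on every input state, the decoder with the exhaustive search carried out for every block takes at most $C\,(n\cdot n_2^2\,4^{n_2}+N^2)$ classical and quantum steps, and the table version takes at most $C N^2$ steps. 4. The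 decoder is polynomial-time: for every $r>0$ there are constants $C,a$ such that for all such codes with inner rate $m/n_2\ge r$, the decoder with the exhaustive search carried out for every block takes at most $C N^a$ steps, and so does the computation of the table. -/

import Mathlib

open scoped Matrix

namespace QZ

/-! ## Additive codes over the field with four elements -/

section Additive

variable {K ι : Type} [Field K] [Fintype ι]

/-- The trace inner product `∑ (u_i * conj v_i + conj u_i * v_i)`, where `conj x = x ^ 2`. -/
def traceInner (u v : ι → K) : K := ∑ i, (u i * v i ^ 2 + u i ^ 2 * v i)

/-- The trace-dual of a set of vectors. -/
def traceDual (S : Set (ι → K)) : Set (ι → K) := {u | ∀ v ∈ S, traceInner u v = 0}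

end Additive

/-! ## Reed–Solomon codes and their binary expansions -/

section ReedSolomon

variable {F : Type} [Field F]

/-- The cyclic code of length `n` whose generator polynomial is the product of
`x - α ^ i` over `0 ≤ i < n - k`; with `d = n - k + 1` this is `0 ≤ i ≤ d - 2`. -/
noncomputable def rsCode (α : F) (n k : ℕ) : Set (Fin n → F) :=
  {c | (∏ i ∈ Finset.range (n - k), (Polynomial.X - Polynomial.C (α ^ i))) ∣
    ∑ i : Fin n, Polynomial.C (c i) * Polynomial.X ^ (i : ℕ)}

/-- The binary expansion of a code of length `n` with respect to a basis of `F` over `𝔽₂`. -/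
def binaryExpansion [Algebra (ZMod 2) F] {m n : ℕ} (b : Module.Basis (Fin m) (ZMod 2) F)
    (C : Set (Fin n → F)) : Set (Fin n → Fin m → ZMod 2) :=
  {c | (fun i => ∑ j, c i j • b j) ∈ C}

/-- The code `ω B + ω̄ B` over `𝔽₄`, for a binary code `B`. -/
def omegaSum {K : Type} [Field K] [Algebra (ZMod 2) K] (ω : K) {m n : ℕ}
    (B : Set (Fin n → Fin m → ZMod 2)) : Set (Fin n → Fin m → K) :=
  {v | ∃ x ∈ B, ∃ y ∈ B, ∀ i j, v i j = x i j • ω + y i j • ω ^ 2}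

end ReedSolomon

/-! ## Step-counted classical computations -/

/-- The result of a classical computation, with the number of elementary steps it took. -/
structure Timed (α : Type) where
  val : α
  steps : ℕ

namespace Timed

variable {α β F : Type}

instance : Monad Timed where
  pure a := ⟨a, 0⟩
  bind x f := ⟨(f x.val).val, x.steps + (f x.val).steps⟩

/-- One elementary operation on bits, symbols of `𝔽₄`, or counters. -/
def op (a : α) : Timed α := ⟨a, 1⟩

/-- One operation in the large field (sum, difference, product, inverse, comparison,
conversion from and to coordinates), charged `w` elementary steps. -/
def fop (w : ℕ) (a : α) : Timed α := ⟨a, w⟩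

/-- A loop over a list; every round costs one step besides those of its body. -/
def loop (body : α → β → Timed α) : List β → α → Timed α
  | [], a => ⟨a, 0⟩
  | x :: xs, a =>
    let r := body a x
    let t := loop body xs r.val
    ⟨t.val, r.steps + 1 + t.steps⟩

/-- Fill an array with `len` entries; each entry costs one step besides its computation. -/
def fill {len : ℕ} (f : Fin len → Timed α) : Timed (Fin len → α) :=
  ⟨fun i => (f i).val, ∑ i, ((f i).steps + 1)⟩

/-- Fill an array of field elements with indices `0, …, len - 1` (entries beyond are `0`). -/
def fillPoly [Zero F] (len : ℕ) (f : ℕ → Timed F) : Timed (ℕ → F) :=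
  ⟨fun i => if i < len then (f i).val else 0, ∑ i ∈ Finset.range len, ((f i).steps + 1)⟩

variable [Field F]

/-- The sum of `len` computed field elements. -/
def fsum (w len : ℕ) (f : ℕ → Timed F) : Timed F :=
  loop (fun acc i => do
    let x ← f i
    fop w (acc + x)) (List.range len) 0

/-- The power `x ^ e` by `e` multiplications. -/
def fpow (w : ℕ) (x : F) (e : ℕ) : Timed F :=
  loop (fun acc _ => fop w (acc * x)) (List.range e) 1

/-- Horner evaluation at `x` of the polynomial with coefficients `c 0, …, c (len - 1)`. -/
def horner (w len : ℕ) (c : ℕ → F) (x : F) : Timed F :=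
  loop (fun acc t => do
    let y ← fop w (acc * x)
    fop w (y + c (len - 1 - t))) (List.range len) 0

end Timed

/-! ## Berlekamp–Massey decoding -/

section BerlekampMassey

open Timed

variable {F : Type} [Field F] [DecidableEq F]

/-- The registers of the Berlekamp–Massey algorithm: the connection polynomial, its value
before the last change of length, the length, the number of rounds since that change,
and the discrepancy at that change. -/
structure BMState (F : Type) where
  conn : ℕ → F
  prev : ℕ → F
  len : ℕ
  shift : ℕ
  disc : F

/-- Round `r` of the Berlekamp–Massey algorithm on the syndromes `S 0, …, S (k - 1)`. -/
def bmStep (w k : ℕ) (S : ℕ → F) (st : BMState F) (r : ℕ) : Timed (BMState F) := do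
  let d ← fsum w (st.len + 1) (fun i => fop w (st.conn i * S (r - i)))
  let isZero ← fop w (decide (d = 0))
  if isZero then
    let shift ← op (st.shift + 1)
    return { st with shift := shift }
  else
    let inv ← fop w (st.disc⁻¹)
    let q ← fop w (d * inv)
    let conn ← fillPoly (k + 1) (fun i => do
      let inRange ← op (decide (st.shift ≤ i))
      if inRange then
        let t ← fop w (q * st.prev (i - st.shift))
        fop w (st.conn i - t)
      else
        return st.conn i)
    let grows ← op (decide (2 * st.len ≤ r))
    if grows then
      let len ← op (r + 1 - st.len)
      return { conn := conn, prev := st.conn, len := len, shift := 1, disc := d }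
    else
      let shift ← op (st.shift + 1)
      return { st with conn := conn, shift := shift }

/-- The error locator polynomial found by the Berlekamp–Massey algorithm. -/
def bmLocator (w k : ℕ) (S : ℕ → F) : Timed (ℕ → F) := do
  let one := fun i : ℕ => if i = 0 then (1 : F) else 0
  let st ← loop (bmStep w k S) (List.range k)
    { conn := one, prev := one, len := 0, shift := 1, disc := 1 }
  return st.conn

/-- Berlekamp–Massey decoding from the syndromes `S r = ∑ i, E i * α ^ (i * (r + 1))`, `r < k`:
the error locator polynomial by the Berlekamp–Massey algorithm, the error positions by trying
all positions, and the error values by Forney's formula. -/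
def bmDecode (w k n : ℕ) (α : F) (S : ℕ → F) : Timed (Fin n → F) := do
  let loc ← bmLocator w k S
  let ev ← fillPoly k (fun t => fsum w (t + 1) (fun i => fop w (S i * loc (t - i))))
  let der ← fillPoly k (fun t => fop w (((t + 1 : ℕ) : F) * loc (t + 1)))
  let αinv ← fop w α⁻¹
  fill (fun i : Fin n => do
    let x ← fpow w αinv i
    let y ← horner w (k + 1) loc x
    let isRoot ← fop w (decide (y = 0))
    if isRoot then
      let a ← horner w k ev x
      let c ← horner w k der x
      let cinv ← fop w c⁻¹
      let e ← fop w (a * cinv)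
      fop w (-e)
    else
      return 0)

end BerlekampMassey

/-! ## Exhaustive syndrome decoding -/

section Exhaustive

open Timed

variable {K : Type} [Field K] [DecidableEq K]

/-- All vectors of length `l` over `{0, 1, ω, ω̄}`. -/
def allVectors (ω : K) : (l : ℕ) → List (Fin l → K)
  | 0 => [Fin.elim0]
  | l + 1 => [0, 1, ω, ω ^ 2].flatMap (fun x => (allVectors ω l).map (Fin.cons x))

/-- The trace inner product computed symbol by symbol, read as a bit. -/
def innerBit {l : ℕ} (u v : Fin l → K) : Timed Bool := do
  let t ← loop (fun acc i => do
    let x ← op (u i * v i ^ 2 + u i ^ 2 * v i)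
    op (acc + x)) (List.finRange l) (0 : K)
  op (decide (t ≠ 0))

/-- The weight computed symbol by symbol. -/
def weightOf {l : ℕ} (u : Fin l → K) : Timed ℕ :=
  loop (fun acc i => do
    let isZero ← op (decide (u i = 0))
    if isZero then return acc else op (acc + 1)) (List.finRange l) 0

/-- Bitwise comparison. -/
def bitsEqual {s : ℕ} (a c : Fin s → Bool) : Timed Bool :=
  loop (fun acc i => op (acc && (a i == c i))) (List.finRange s) true

/-- Exhaustive search: among all vectors of length `l`, find one of least weight whose
syndrome with respect to the generators `g` is `σ`. Each candidate is written down
in `l` steps. -/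
def exhaustiveSearch (ω : K) {l s : ℕ} (g : Fin s → Fin l → K) (σ : Fin s → Bool) :
    Timed (Fin l → K) := do
  let best ← loop (fun (best : Option (ℕ × (Fin l → K))) (e : Fin l → K) => do
    let cand ← fill (fun i => op (e i))
    let syn ← fill (fun j => innerBit cand (g j))
    let same ← bitsEqual syn σ
    if same then
      let wt ← weightOf cand
      match best with
      | none => op (some (wt, cand))
      | some (wt', e') => op (if wt < wt' then some (wt, cand) else some (wt', e'))
    else
      return best) (allVectors ω l) none
  match best with
  | none => op (fun _ => 0)
  | some (_, e) => op e

/-- Tabulate the result of the exhaustive search for every syndrome. -/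
def buildTable (ω : K) {l s : ℕ} (g : Fin s → Fin l → K) :
    Timed ((Fin s → Bool) → Fin l → K) :=
  ⟨fun σ => (exhaustiveSearch ω g σ).val,
    ∑ σ : Fin s → Bool, ((exhaustiveSearch ω g σ).steps + s + l)⟩

/-- Read the entry of a table at an address of `s` bits, symbol by symbol. -/
def lookup {l s : ℕ} (T : (Fin s → Bool) → Fin l → K) (σ : Fin s → Bool) : Timed (Fin l → K) :=
  ⟨T σ, s + l⟩

end Exhaustive

/-! ## Qubits, Pauli operators, stabilizer codes, and programs with measurements -/

section Quantum

variable {K ι : Type} [Field K] [DecidableEq K] [Fintype ι] [DecidableEq ι]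

/-- (Unnormalized) state vectors of the qubits with labels in `ι`. -/
abbrev State (ι : Type) := (ι → Fin 2) → ℂ

/-- `0, ω, 1, ω̄` stand for the identity and the Pauli matrices `X`, `Y`, `Z`. -/
noncomputable def pauli1 (ω x : K) : Matrix (Fin 2) (Fin 2) ℂ :=
  if x = 0 then 1
  else if x = ω then !![0, 1; 1, 0]
  else if x = 1 then !![0, -Complex.I; Complex.I, 0]
  else !![1, 0; 0, -1]

/-- The tensor product of Pauli matrices that a vector over `𝔽₄` stands for. -/
noncomputable def pauli (ω : K) (u : ι → K) : Matrix (ι → Fin 2) (ι → Fin 2) ℂ :=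
  Matrix.of fun x y => ∏ q, pauli1 ω (u q) (x q) (y q)

/-- The sign `(-1) ^ b`. -/
def sign (b : Bool) : ℂ := if b then -1 else 1

/-- The stabilizer code of a self-orthogonal additive code `S` for the signs `χ`: the common
eigenspace of the operators `pauli ω c`, `c ∈ S`, to the eigenvalues `sign (χ c)`. -/
def codeSpace (ω : K) (S : Set (ι → K)) (χ : (ι → K) → Bool) : Set (State ι) :=
  {ψ | ∀ c ∈ S, pauli ω c *ᵥ ψ = sign (χ c) • ψ}

/-- Error operators on at most `t` qubits: the linear combinations of tensor products of
Pauli matrices that differ from the identity in at most `t` places. -/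
def errorSpace (ω : K) (ι : Type) [Fintype ι] [DecidableEq ι] (t : ℝ) :
    Submodule ℂ (Matrix (ι → Fin 2) (ι → Fin 2) ℂ) :=
  Submodule.span ℂ {A | ∃ e : ι → K, (hammingNorm e : ℝ) ≤ t ∧ A = pauli ω e}

/-- Programs of a quantum computer with classical control: stop with a result, spend classical
steps, apply a Pauli matrix to one qubit, measure a tensor product of Pauli matrices. -/
inductive QProg (K ι : Type) (α : Type) : Type where
  | ret (a : α) : QProg K ι α
  | work (c : ℕ) (p : QProg K ι α) : QProg K ι α
  | gate (q : ι) (x : K) (p : QProg K ι α) : QProg K ι α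
  | measure (g : ι → K) (next : Bool → QProg K ι α) : QProg K ι α

namespace QProg

variable {α β : Type}

/-- Run one program after another. -/
def seq (f : α → QProg K ι β) : QProg K ι α → QProg K ι β
  | ret a => f a
  | work c p => work c (seq f p)
  | gate q x p => gate q x (seq f p)
  | measure g next => measure g (fun o => seq f (next o))

instance : Monad (QProg K ι) where
  pure := ret
  bind p f := seq f p

/-- A classical computation as a part of a program. -/
def classical (t : Timed α) : QProg K ι α := work t.steps (ret t.val)

/-- Carry out a family of programs one after another and collect the results. -/
def collect : {len : ℕ} → (Fin len → QProg K ι α) → QProg K ι (Fin len → α)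
  | 0, _ => ret Fin.elim0
  | _ + 1, p => do
    let a ← p 0
    let as ← collect (fun i => p i.succ)
    work 1 (ret (Fin.cons a as : Fin (_ + 1) → α))

/-- Measure a stabilizer element and compare the outcome with its eigenvalue on the code. -/
def syndromeBit (χ : (ι → K) → Bool) (g : ι → K) : QProg K ι Bool :=
  measure g (fun o => work 1 (ret (xor o (χ g))))

/-- A branch of a run: the unnormalized final state for one sequence of measurement
outcomes, and the number of classical and quantum steps on the way. -/
structure Branch (ι α : Type) where
  result : α
  state : State ι
  steps : ℕ

/-- All branches of a run. Measuring `P = pauli ω g` applies the projection `(1 + P) / 2` (outcome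
`false`) or `(1 - P) / 2` (outcome `true`); it takes one two-qubit gate for each place where
`P` is not the identity, and four operations on an ancilla. -/
noncomputable def run (ω : K) : QProg K ι α → State ι → List (Branch ι α)
  | ret a, ψ => [⟨a, ψ, 0⟩]
  | work c p, ψ => (run ω p ψ).map (fun B => ⟨B.result, B.state, B.steps + c⟩)
  | gate q x p, ψ =>
    (run ω p (pauli ω (Pi.single q x) *ᵥ ψ)).map (fun B => ⟨B.result, B.state, B.steps + 1⟩)
  | measure g next, ψ =>
    ([false, true].flatMap fun o =>
      run ω (next o) ((2⁻¹ : ℂ) • (ψ + sign o • (pauli ω g *ᵥ ψ)))).map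
        (fun B => ⟨B.result, B.state, B.steps + (hammingNorm g + 4)⟩)

end QProg

end Quantum

/-! ## Quantum Zyablov codes -/

/-- The data of a quantum Zyablov code: a quantum Reed–Solomon outer code with parameters
`[[n m, m (n - 2 k)]]` over `F = 𝔽_{2^m}`, a stabilizer inner code with parameters
`[[n₂, m, δ₂ n₂]]`, and an inner-product-preserving map `ρ` for the concatenation. -/
structure ZyablovCode (K F : Type) [Field K] [DecidableEq K] [Algebra (ZMod 2) K]
    [Field F] [Algebra (ZMod 2) F] (m n k n₂ s : ℕ) where
  card_K : Nat.card K = 4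
  ω : K
  ω_sq : ω ^ 2 = ω + 1
  length_eq : n + 1 = 2 ^ m
  k_pos : 1 ≤ k
  k_le : k ≤ 2 ^ (m - 1) - 1
  /-- a primitive element of `F` -/
  α : F
  α_primitive : orderOf α = n
  /-- a self-dual basis of `F` -/
  b : Module.Basis (Fin m) (ZMod 2) F
  self_dual : ∀ i j, Algebra.trace (ZMod 2) F (b i * b j) = if i = j then 1 else 0
  inner_length_eq : s + m = n₂
  /-- generators of the additive code associated with the inner code -/
  gen : Fin s → Fin n₂ → K
  card_inner : Nat.card (AddSubgroup.closure (Set.range gen)) = 2 ^ s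
  self_orthogonal : (AddSubgroup.closure (Set.range gen) : Set (Fin n₂ → K)) ⊆
    traceDual (AddSubgroup.closure (Set.range gen))
  /-- the relative minimum distance of the inner code (or a lower bound on it) -/
  δ₂ : ℝ
  inner_dist : ∀ c ∈ traceDual (AddSubgroup.closure (Set.range gen) : Set (Fin n₂ → K)),
    c ∉ AddSubgroup.closure (Set.range gen) → δ₂ * n₂ ≤ hammingNorm c
  /-- representatives of the images of an inner-product-preserving map from `𝔽₄^m` to the
  quotient of the dual of the inner additive code by that code -/
  ρ : (Fin m → K) →+ (Fin n₂ → K)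
  ρ_mem : ∀ v, ρ v ∈ traceDual (AddSubgroup.closure (Set.range gen) : Set (Fin n₂ → K))
  ρ_inner : ∀ u v, traceInner (ρ u) (ρ v) = traceInner u v

namespace ZyablovCode

variable {K F : Type} [Field K] [DecidableEq K] [Algebra (ZMod 2) K]
  [Field F] [DecidableEq F] [Algebra (ZMod 2) F] {m n k n₂ s : ℕ}

/-- The additive code associated with the inner code. -/
def C₂ (Z : ZyablovCode K F m n k n₂ s) : AddSubgroup (Fin n₂ → K) :=
  AddSubgroup.closure (Set.range Z.gen)

/-- The additive code associated with the quantum Reed–Solomon code. -/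
noncomputable def C₁ (Z : ZyablovCode K F m n k n₂ s) : Set (Fin n → Fin m → K) :=
  omegaSum Z.ω (binaryExpansion Z.b (rsCode Z.α n k))

/-- The additive code `ρ(C₁)` associated with the quantum Zyablov code. -/
noncomputable def stabilizer (Z : ZyablovCode K F m n k n₂ s) : Set (Fin n × Fin n₂ → K) :=
  {c | ∃ v ∈ Z.C₁, ∃ u : Fin n → Fin n₂ → K, (∀ i, u i ∈ Z.C₂) ∧
    ∀ p, c p = Z.ρ (v p.1) p.2 + u p.1 p.2}

/-- The number of qubits of the quantum Zyablov code. -/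
def numQubits (_Z : ZyablovCode K F m n k n₂ s) : ℕ := n * n₂

/-- The lower bound `δ = δ₂ * (k / n)` on the relative minimum distance. -/
noncomputable def δ (Z : ZyablovCode K F m n k n₂ s) : ℝ := Z.δ₂ * ((k : ℝ) / n)

/-- Programs on the qubits of the code. -/
abbrev Prog (_Z : ZyablovCode K F m n k n₂ s) (α : Type) := QProg K (Fin n × Fin n₂) α

/-- The vector that is `u` in the inner block `i` and zero elsewhere. -/
def blockVec (_Z : ZyablovCode K F m n k n₂ s) (i : Fin n) (u : Fin n₂ → K) :
    Fin n × Fin n₂ → K :=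
  fun p => if p.1 = i then u p.2 else 0

/-- Apply the Pauli matrices given by `u` to the qubits of block `i`. -/
def applyBlock (Z : ZyablovCode K F m n k n₂ s) (i : Fin n) (u : Fin n₂ → K) : Z.Prog Unit := do
  let _ ← QProg.collect (fun q : Fin n₂ => (QProg.gate (i, q) (u q) (QProg.ret ()) : Z.Prog Unit))
  return ()

/-- Inner decoding. For each block: measure the generators of the inner code, estimate a most
likely error from the syndrome with `est`, and correct it. -/
def innerStage (Z : ZyablovCode K F m n k n₂ s) (est : (Fin s → Bool) → Timed (Fin n₂ → K))
    (χ : (Fin n × Fin n₂ → K) → Bool) : Z.Prog Unit := do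
  let _ ← QProg.collect (fun i : Fin n => (do
    let σ ← QProg.collect (fun j : Fin s => QProg.syndromeBit χ (Z.blockVec i (Z.gen j)))
    let e ← QProg.classical (est σ)
    Z.applyBlock i e : Z.Prog Unit))
  return ()

/-- The encoded stabilizer elements of the outer code: `ρ` applied blockwise to `x` times the
binary expansion of the codeword `(b_j * α ^ (i * (l + 1)))_i`, where `x` is `ω` or `ω̄`. -/
noncomputable def outerGen (Z : ZyablovCode K F m n k n₂ s) (x : K) (l : Fin k) (j : Fin m) :
    Fin n × Fin n₂ → K :=
  fun p => Z.ρ (fun j' => Z.b.repr (Z.b j * Z.α ^ ((p.1 : ℕ) * ((l : ℕ) + 1))) j' • x) p.2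

/-- Measure the syndromes in `F` of one of the two halves of the outer code; operations in `F`
are charged `m ^ 2` steps. -/
noncomputable def outerSyndrome (Z : ZyablovCode K F m n k n₂ s) (x : K)
    (χ : (Fin n × Fin n₂ → K) → Bool) : Z.Prog (ℕ → F) := do
  let S ← QProg.collect (fun l : Fin k => (do
    let bits ← QProg.collect (fun j : Fin m => QProg.syndromeBit χ (Z.outerGen x l j))
    QProg.classical (Timed.loop (fun (acc : F) (j : Fin m) =>
      Timed.fop (m ^ 2) (if bits j then acc + Z.b j else acc)) (List.finRange m) 0) : Z.Prog F))
  return (fun l => if h : l < k then S ⟨l, h⟩ else 0)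

/-- The encoding of one block symbol: `ρ` of the vector with entries `x j • ω + y j • ω̄`, computed
from the images under `ρ` of the vectors with a single nonzero entry. -/
def encodeSymbol (Z : ZyablovCode K F m n k n₂ s) (x y : Fin m → ZMod 2) :
    Timed (Fin n₂ → K) :=
  Timed.fill (fun q => Timed.loop (fun (acc : K) (j : Fin m) => do
    let t ← Timed.op (x j • Z.ρ (Pi.single j Z.ω) q)
    let acc ← Timed.op (acc + t)
    let t' ← Timed.op (y j • Z.ρ (Pi.single j (Z.ω ^ 2)) q)
    Timed.op (acc + t')) (List.finRange m) 0)

/-- Outer decoding: measure the syndromes of the two halves (of CSS type) of the quantum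
Reed–Solomon code, decode each with the Berlekamp–Massey algorithm, and correct. The elements
`ω x` detect the `ω̄`-part of an error, and conversely. -/
noncomputable def outerStage (Z : ZyablovCode K F m n k n₂ s)
    (χ : (Fin n × Fin n₂ → K) → Bool) : Z.Prog Unit := do
  let SY ← Z.outerSyndrome Z.ω χ
  let SX ← Z.outerSyndrome (Z.ω ^ 2) χ
  let X ← QProg.classical (bmDecode (m ^ 2) k n Z.α SX)
  let Y ← QProg.classical (bmDecode (m ^ 2) k n Z.α SY)
  let _ ← QProg.collect (fun i : Fin n => (do
    let x ← QProg.classical (Timed.fop (m ^ 2) (fun j => Z.b.repr (X i) j))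
    let y ← QProg.classical (Timed.fop (m ^ 2) (fun j => Z.b.repr (Y i) j))
    let e ← QProg.classical (Z.encodeSymbol x y)
    Z.applyBlock i e : Z.Prog Unit))
  return ()

/-- The two-stage decoder, with a given estimation procedure for the inner blocks. -/
noncomputable def decoder (Z : ZyablovCode K F m n k n₂ s)
    (est : (Fin s → Bool) → Timed (Fin n₂ → K)) (χ : (Fin n × Fin n₂ → K) → Bool) :
    Z.Prog Unit := do
  Z.innerStage est χ
  Z.outerStage χ

/-- The two-stage decoder that searches exhaustively for every inner block. -/
noncomputable def searchDecoder (Z : ZyablovCode K F m n k n₂ s) :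
    ((Fin n × Fin n₂ → K) → Bool) → Z.Prog Unit :=
  Z.decoder (exhaustiveSearch Z.ω Z.gen)

/-- The two-stage decoder that reads the results of the exhaustive search from a table, which
is computed once for the code. -/
noncomputable def tableDecoder (Z : ZyablovCode K F m n k n₂ s) :
    ((Fin n × Fin n₂ → K) → Bool) → Z.Prog Unit :=
  Z.decoder (lookup (buildTable Z.ω Z.gen).val)

/-- The decoder restores, up to a scalar and in every branch, each state of the code (for every
choice of signs) that was hit by an error on at most `t` qubits. -/
def Corrects (Z : ZyablovCode K F m n k n₂ s)
    (dec : ((Fin n × Fin n₂ → K) → Bool) → Z.Prog Unit) (t : ℝ) : Prop :=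
  ∀ χ : (Fin n × Fin n₂ → K) → Bool, ∀ ψ ∈ codeSpace Z.ω Z.stabilizer χ,
    ∀ E ∈ errorSpace Z.ω (Fin n × Fin n₂) t,
      ∀ B ∈ QProg.run Z.ω (dec χ) (E *ᵥ ψ), ∃ z : ℂ, B.state = z • ψ

/-- Every branch takes at most `T` classical and quantum steps. -/
def RunsWithin (Z : ZyablovCode K F m n k n₂ s)
    (dec : ((Fin n × Fin n₂ → K) → Bool) → Z.Prog Unit) (T : ℕ) : Prop :=
  ∀ (χ : (Fin n × Fin n₂ → K) → Bool) (φ : State (Fin n × Fin n₂)),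
    ∀ B ∈ QProg.run Z.ω (dec χ) φ, B.steps ≤ T

end ZyablovCode

end QZ

/-! Errors are discretised. Along a fixed sequence of outcomes the decoder acts linearly on the
state, and it measures only stabilizer elements. On a code state hit by a Pauli error each outcome
is therefore forced by a commutation sign, and the opposite outcome leaves the zero vector. So
quantum correctness reduces to a classical statement about `sim`, which tracks the error vector over
𝔽₄ (`endsIn_of_sim`, `endsIn_span_of_sim`): every vector of weight at most δN/4 must be carried into
the stabilizer.

Since ρ preserves the form and dimensions match, C₂^⊥ is the sum of ρ(𝔽₄^m) and C₂
(`exists_rho_add`). A vector whose blocks all lie in C₂^⊥ is thus, modulo C₂, a pair of words x, y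
over F: its ω-part and its ω̄-part. Pairing with the ω-generators sees only y, pairing with the
ω̄-generators only x, and because the basis is self-dual the m bits belonging to one l are the
coordinates of a power sum ∑ Y_i α^(i(l+1)) (`sum_repr_mul`).

For a vector of S^⊥ all k power sums vanish. By a Vandermonde argument a nonzero word then has more
than k nonzero symbols, and each of them forces a block in C₂^⊥ ∖ C₂, of weight at least δ₂n₂
(`distance_le`).

For decoding, a block left wrong by the least-weight search has a residual in C₂^⊥ ∖ C₂ of weight at
most twice that of its error, hence it contained at least δ₂n₂/2 errors, and at most k/2 blocks are
wrong (`two_mul_card_le_of_inner`). Then k syndromes suffice for Berlekamp–Massey (`bmDecode_val`):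
the register length never exceeds the number of errors, so at the end enough consecutive
discrepancies vanish to identify the connection polynomial with the error locator.

Running times are bounded by the worst branch, whatever the outcomes. Polynomiality rests on 2^m = n
+ 1: if m ≥ r n₂, then 4^n₂ is at most a fixed power of N (`four_pow_le`). -/

namespace QZ

/-! ## Values of step-counted computations -/

namespace Timed

variable {α β F : Type}

@[simp] theorem val_bind (x : Timed α) (f : α → Timed β) : (x >>= f).val = (f x.val).val := rfl

@[simp] theorem val_pure (a : α) : (pure a : Timed α).val = a := rfl

@[simp] theorem val_op (a : α) : (op a).val = a := rfl

@[simp] theorem val_fop (w : ℕ) (a : α) : (fop w a).val = a := rfl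

@[simp] theorem val_ite (c : Prop) [Decidable c] (x y : Timed α) :
    (if c then x else y).val = if c then x.val else y.val := apply_ite _ _ _ _

@[simp] theorem val_fill {len : ℕ} (f : Fin len → Timed α) :
    (fill f).val = fun i => (f i).val := rfl

@[simp] theorem val_fillPoly [Zero F] (len : ℕ) (f : ℕ → Timed F) :
    (fillPoly len f).val = fun i => if i < len then (f i).val else 0 := rfl

theorem val_loop (body : α → β → Timed α) (l : List β) (a : α) :
    (loop body l a).val = l.foldl (fun a x => (body a x).val) a := by
  induction l generalizing a with
  | nil => rfl
  | cons x xs ih => simp [loop, ih]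

/-- An invariant of the rounds of a loop over `0, …, len - 1` holds at its end. -/
theorem loop_range_invariant (body : α → ℕ → Timed α) (P : ℕ → α → Prop) (len : ℕ) (a : α)
    (h0 : P 0 a) (hstep : ∀ r < len, ∀ a, P r a → P (r + 1) (body a r).val) :
    P len (loop body (List.range len) a).val := by
  rw [val_loop]
  induction len with
  | zero => simpa using h0
  | succ l ih =>
    rw [List.range_succ, List.foldl_append]
    exact hstep l (Nat.lt_succ_self l) _ (ih fun r hr => hstep r (hr.trans (Nat.lt_succ_self l)))

variable [Field F]

@[simp] theorem val_fsum (w len : ℕ) (f : ℕ → Timed F) :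
    (fsum w len f).val = ∑ i ∈ Finset.range len, (f i).val := by
  refine loop_range_invariant _ (fun r a => a = ∑ i ∈ Finset.range r, (f i).val) len 0 (by simp) ?_
  rintro r - a rfl
  simp [Finset.sum_range_succ]

@[simp] theorem val_fpow (w : ℕ) (x : F) (e : ℕ) : (fpow w x e).val = x ^ e := by
  refine loop_range_invariant _ (fun r a => a = x ^ r) e 1 (by simp) ?_
  rintro r - a rfl
  simp [pow_succ]

/-- One round of Horner's rule: after r rounds the accumulator holds the polynomial formed by the
top r coefficients. -/
theorem sum_mul_pow_succ (c : ℕ → F) (x : F) (len r : ℕ) (h : r < len) :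
    (∑ i ∈ Finset.range r, c (len - r + i) * x ^ i) * x + c (len - 1 - r) =
      ∑ i ∈ Finset.range (r + 1), c (len - (r + 1) + i) * x ^ i := by
  rw [Finset.sum_range_succ', Finset.sum_mul]
  congr 1
  · refine Finset.sum_congr rfl fun i _ => ?_
    rw [show len - (r + 1) + (i + 1) = len - r + i by omega]
    ring
  · rw [show len - (r + 1) + 0 = len - 1 - r by omega]
    ring

@[simp] theorem val_horner (w len : ℕ) (c : ℕ → F) (x : F) :
    (horner w len c x).val = ∑ i ∈ Finset.range len, c i * x ^ i := by
  have := loop_range_invariant (fun (acc : F) t => (do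
    let y ← fop w (acc * x)
    fop w (y + c (len - 1 - t)) : Timed F))
    (fun r a => a = ∑ i ∈ Finset.range r, c (len - r + i) * x ^ i) len 0 (by simp) ?_
  · exact this.trans (by simp)
  · rintro r hr a rfl
    simpa using sum_mul_pow_succ c x len r hr

end Timed

/-! ## Correctness of Berlekamp–Massey decoding -/

section BerlekampMassey

open Polynomial

variable {F ι : Type} [Field F]

/-- Vandermonde in Lagrange form: the hypotheses make the functional Q ↦ ∑ g(q) X(q)^a Q(X(q))
vanish on all polynomials of degree below |T|. Testing it on the product of the other linear factors
isolates g(p). This serves both the uniqueness of the locator and the distance of the outer code. -/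
theorem eq_zero_of_sum_mul_pow_eq_zero (T : Finset ι) (X g : ι → F) (hX : Set.InjOn X T) (a : ℕ)
    (hX0 : ∀ p ∈ T, X p ≠ 0) (h : ∀ j < T.card, ∑ p ∈ T, g p * X p ^ (a + j) = 0) :
    ∀ p ∈ T, g p = 0 := by
  classical
  intro p hp
  have key : ∀ Q : F[X], Q.natDegree < T.card → ∑ q ∈ T, g q * X q ^ a * Q.eval (X q) = 0 := by
    intro Q hQ
    simp_rw [eval_eq_sum_range' hQ, Finset.mul_sum]
    rw [Finset.sum_comm]
    refine Finset.sum_eq_zero fun j hj => ?_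
    have := congrArg (fun z => Q.coeff j * z) (h j (Finset.mem_range.1 hj))
    simp only [Finset.mul_sum, mul_zero] at this
    rw [← this]
    refine Finset.sum_congr rfl fun q _ => ?_
    rw [pow_add]; ring
  have h1 := key (∏ q ∈ T.erase p, (Polynomial.X - C (X q))) (by
    rw [natDegree_prod_of_monic _ _ fun q _ => monic_X_sub_C _]
    simp [Finset.card_erase_of_mem hp, Finset.card_pos.2 ⟨p, hp⟩])
  rw [Finset.sum_eq_single p] at h1
  · rw [eval_prod] at h1
    have h2 : ∏ q ∈ T.erase p, eval (X p) (Polynomial.X - C (X q)) ≠ 0 := by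
      refine Finset.prod_ne_zero_iff.2 fun q hq => ?_
      have hq' := Finset.mem_erase.1 hq
      simp only [eval_sub, eval_X, eval_C]
      exact sub_ne_zero.2 fun e => hq'.1 (hX hp hq'.2 e).symm
    have h3 := pow_ne_zero a (hX0 p hp)
    exact (mul_eq_zero.1 ((mul_eq_zero.1 h1).resolve_right h2)).resolve_right h3
  · intro q hq hqp
    rw [eval_prod, Finset.prod_eq_zero (Finset.mem_erase.2 ⟨hqp, hq⟩), mul_zero]
    simp
  · exact fun h => absurd hp h

/-- The `j`-th discrepancy of a connection polynomial for the syndromes of the errors `E p` at the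
locators `X p`, in terms of its values at the inverse locators. -/
noncomputable def discrepancy (T : Finset ι) (E X : ι → F) (P : F[X]) (j : ℕ) : F :=
  ∑ p ∈ T, E p * X p ^ (j + 1) * P.eval (X p)⁻¹

variable {T : Finset ι} {E X : ι → F}

/-- Links the sum computed from the registers to evaluations at inverse locators. The bound L ≤ r
keeps the subtraction r - i from being truncated. -/
theorem sum_coeff_mul_syndrome {k L r : ℕ} {S : ℕ → F} {P : F[X]} (hX0 : ∀ p ∈ T, X p ≠ 0)
    (hS : ∀ r < k, S r = ∑ p ∈ T, E p * X p ^ (r + 1)) (hP : P.natDegree ≤ L) (hL : L ≤ r)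
    (hr : r < k) :
    ∑ i ∈ Finset.range (L + 1), P.coeff i * S (r - i) = discrepancy T E X P r := by
  simp only [discrepancy, eval_eq_sum_range' (Nat.lt_succ_of_le hP), Finset.mul_sum]
  rw [Finset.sum_comm]
  refine Finset.sum_congr rfl fun i hi => ?_
  have hi' : i ≤ r := (Nat.lt_succ_iff.1 (Finset.mem_range.1 hi)).trans hL
  rw [hS _ (by omega), Finset.mul_sum]
  refine Finset.sum_congr rfl fun p hp => ?_
  have h1 : X p ^ (r + 1) = X p ^ (r - i + 1) * X p ^ i := by
    rw [← pow_add, show r - i + 1 + i = r + 1 by omega]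
  rw [h1, inv_pow]
  field_simp [hX0 p hp]

theorem discrepancy_sub (P Q : F[X]) (j : ℕ) :
    discrepancy T E X (P - Q) j = discrepancy T E X P j - discrepancy T E X Q j := by
  simp [discrepancy, mul_sub]

/-- A factor X^m evaluated at an inverse locator lowers the exponent of the locator by m. -/
theorem discrepancy_shift (hX0 : ∀ p ∈ T, X p ≠ 0) (q : F) (P : F[X]) (m j : ℕ) :
    discrepancy T E X (C q * (Polynomial.X ^ m * P)) (j + m) = q * discrepancy T E X P j := by
  simp only [discrepancy, Finset.mul_sum]
  refine Finset.sum_congr rfl fun p hp => ?_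
  simp only [eval_mul, eval_C, eval_pow, eval_X, inv_pow]
  rw [show j + m + 1 = (j + 1) + m by omega, pow_add]
  field_simp [hX0 p hp]

/-- A run of |T| zero discrepancies is a Vandermonde system for the products E(p)·P(X(p)⁻¹), and the
error values can be cancelled. -/
theorem eval_inv_eq_zero_of_discrepancy (hX : Set.InjOn X T) (hX0 : ∀ p ∈ T, X p ≠ 0)
    (hE : ∀ p ∈ T, E p ≠ 0) (P : F[X]) (a : ℕ)
    (h : ∀ j < T.card, discrepancy T E X P (a + j) = 0) : ∀ p ∈ T, P.eval (X p)⁻¹ = 0 := by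
  have := eq_zero_of_sum_mul_pow_eq_zero T X (fun p => E p * P.eval (X p)⁻¹) hX (a + 1) hX0 (by
    intro j hj
    rw [← h j hj, discrepancy]
    refine Finset.sum_congr rfl fun p _ => ?_
    rw [show a + 1 + j = a + j + 1 by omega]; ring)
  exact fun p hp => (mul_eq_zero.1 (this p hp)).resolve_left (hE p hp)

/-- The invariant of the Berlekamp–Massey algorithm: `P` and `Q` are the polynomials in the first
two registers, and `L₀` is the length before the last change of length. -/
structure BMInvariant (T : Finset ι) (E X : ι → F) (r : ℕ) (st : BMState F) (P Q : F[X])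
    (L₀ : ℕ) : Prop where
  conn : ∀ i, st.conn i = P.coeff i
  prev : ∀ i, st.prev i = Q.coeff i
  coeff_zero : P.coeff 0 = 1
  natDegree_conn : P.natDegree ≤ st.len
  natDegree_prev : Q.natDegree ≤ L₀
  shift_pos : 1 ≤ st.shift
  -- The last change happened in round r - shift and took the length from L₀ to r - shift + 1 - L₀;
  -- the initial registers satisfy the same equation.
  shift_eq : st.shift + L₀ + st.len = r + 1
  disc_ne : st.disc ≠ 0
  len_le : st.len ≤ T.card
  generates : ∀ j, st.len ≤ j → j < r → discrepancy T E X P j = 0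
  generates_prev : st.len = 0 ∨ discrepancy T E X Q (L₀ + st.len - 1) = st.disc ∧
    ∀ j, L₀ ≤ j → j < L₀ + st.len - 1 → discrepancy T E X Q j = 0

/-- The shift moves the nonzero discrepancy of Q exactly to r, where the factor makes it cancel that
of P; at earlier indices both terms vanish already. -/
theorem BMInvariant.discrepancy_update {r : ℕ} {st : BMState F} {P Q : F[X]} {L₀ : ℕ}
    (h : BMInvariant T E X r st P Q L₀) (hX0 : ∀ p ∈ T, X p ≠ 0) (j : ℕ) (hj : j ≤ r)
    (h1 : st.len ≤ j) (h2 : st.shift + L₀ ≤ j) :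
    discrepancy T E X
      (P - C (discrepancy T E X P r * st.disc⁻¹) * (Polynomial.X ^ st.shift * Q)) j = 0 := by
  obtain ⟨i, rfl⟩ : ∃ i, j = i + st.shift := ⟨j - st.shift, by omega⟩
  have hs := h.shift_eq
  rw [discrepancy_sub, discrepancy_shift hX0]
  rcases h.generates_prev with h0 | ⟨hd, hz⟩
  -- With length 0, `shift_eq` gives shift + L₀ = r + 1, so no index j ≤ r meets `h2`.
  · omega
  · rcases hj.lt_or_eq with hlt | heq
    · rw [h.generates _ h1 hlt, hz i (by omega) (by omega)]; simp
    · rw [show i = L₀ + st.len - 1 by omega, hd,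
        show L₀ + st.len - 1 + st.shift = r by omega,
        mul_assoc, inv_mul_cancel₀ h.disc_ne, mul_one, sub_self]

/-- Were the new length larger than |T|, the polynomial P would already have |T| consecutive zero
discrepancies, hence vanish at all inverse locators, and its discrepancy at r would be zero too. -/
theorem BMInvariant.length_change_le {r : ℕ} {st : BMState F} {P Q : F[X]} {L₀ : ℕ}
    (h : BMInvariant T E X r st P Q L₀) (hX : Set.InjOn X T) (hX0 : ∀ p ∈ T, X p ≠ 0)
    (hE : ∀ p ∈ T, E p ≠ 0) (hd : discrepancy T E X P r ≠ 0) : r + 1 - st.len ≤ T.card := by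
  by_contra! hlt
  refine hd ?_
  have := eval_inv_eq_zero_of_discrepancy hX hX0 hE P st.len fun j hj =>
    h.generates _ (by omega) (by omega)
  exact Finset.sum_eq_zero fun p hp => by rw [this p hp, mul_zero]

theorem natDegree_locator_le (T : Finset ι) (X : ι → F) :
    (∏ q ∈ T, (1 - C (X q) * Polynomial.X)).natDegree ≤ T.card := by
  refine (natDegree_prod_le _ _).trans ?_
  refine (Finset.sum_le_sum (g := fun _ => 1) fun p _ => ?_).trans (by simp)
  exact (natDegree_sub_le _ _).trans (max_le (by simp) ((natDegree_C_mul_le _ _).trans natDegree_X_le))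

/-- Two polynomials of degree at most |T| that agree at |T| + 1 points: the inverse locators and 0.
-/
theorem eq_prod_of_eval_inv_eq_zero (hX : Set.InjOn X T) (hX0 : ∀ p ∈ T, X p ≠ 0) {P : F[X]}
    (h0 : P.coeff 0 = 1) (hdeg : P.natDegree ≤ T.card) (h : ∀ p ∈ T, P.eval (X p)⁻¹ = 0) :
    P = ∏ p ∈ T, (1 - C (X p) * Polynomial.X) := by
  classical
  set R : F[X] := ∏ p ∈ T, (1 - C (X p) * Polynomial.X) with hR
  have hRdeg : R.natDegree ≤ T.card := natDegree_locator_le T X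
  have hz : (0 : F) ∉ T.image fun p => (X p)⁻¹ := by
    simp only [Finset.mem_image, inv_eq_zero, not_exists, not_and]
    exact fun p hp => hX0 p hp
  have hcard : (insert (0 : F) (T.image fun p => (X p)⁻¹)).card = T.card + 1 := by
    rw [Finset.card_insert_of_notMem hz, Finset.card_image_of_injOn]
    exact fun p hp q hq e => hX hp hq (inv_injective e)
  rw [← sub_eq_zero]
  refine eq_zero_of_natDegree_lt_card_of_eval_eq_zero' _ (insert (0 : F) (T.image fun p => (X p)⁻¹))
    ?_ ?_
  · intro x hx
    rcases Finset.mem_insert.1 hx with rfl | hx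
    · rw [eval_sub, ← coeff_zero_eq_eval_zero, h0, hR, eval_prod]
      simp
    · obtain ⟨p, hp, rfl⟩ := Finset.mem_image.1 hx
      rw [eval_sub, h p hp, hR, eval_prod, Finset.prod_eq_zero hp]
      · simp
      · simp [hX0 p hp]
  · rw [hcard]
    exact Nat.lt_succ_of_le ((natDegree_sub_le _ _).trans (max_le hdeg hRdeg))

/-- Multiplication by the geometric series of X(p) divides the locator by its factor 1 - X(p)x. -/
theorem sum_pow_mul_coeff_locator [DecidableEq ι] {p : ι} (hp : p ∈ T) (t : ℕ) :
    ∑ i ∈ Finset.range (t + 1), X p ^ i *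
      (∏ q ∈ T, (1 - C (X q) * Polynomial.X)).coeff (t - i) =
      (∏ q ∈ T.erase p, (1 - C (X q) * Polynomial.X)).coeff t := by
  set R : F[X] := ∏ q ∈ T.erase p, (1 - C (X q) * Polynomial.X) with hR
  have hmul : ∏ q ∈ T, (1 - C (X q) * Polynomial.X) = (1 - C (X p) * Polynomial.X) * R :=
    (Finset.mul_prod_erase _ _ hp).symm
  rw [hmul]
  have hco : (1 - C (X p) * Polynomial.X) * R = R - C (X p) * (Polynomial.X * R) := by ring
  rw [hco]
  induction t with
  | zero => simp
  | succ t ih =>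
    rw [Finset.sum_range_succ']
    have : ∀ i ∈ Finset.range (t + 1), X p ^ (i + 1) *
        (R - C (X p) * (Polynomial.X * R)).coeff (t + 1 - (i + 1)) =
        X p * (X p ^ i * (R - C (X p) * (Polynomial.X * R)).coeff (t - i)) := by
      intro i _
      rw [Nat.add_sub_add_right]; ring
    rw [Finset.sum_congr rfl this, ← Finset.mul_sum, ih]
    simp

/-- The error evaluator polynomial. -/
theorem sum_syndrome_mul_coeff_locator [DecidableEq ι] {k : ℕ} {S : ℕ → F}
    (hS : ∀ r < k, S r = ∑ p ∈ T, E p * X p ^ (r + 1)) {t : ℕ} (ht : t < k) :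
    ∑ i ∈ Finset.range (t + 1), S i * (∏ q ∈ T, (1 - C (X q) * Polynomial.X)).coeff (t - i) =
      (∑ p ∈ T, C (E p * X p) * ∏ q ∈ T.erase p, (1 - C (X q) * Polynomial.X)).coeff t := by
  rw [finsetSum_coeff]
  have : ∀ i ∈ Finset.range (t + 1),
      S i * (∏ q ∈ T, (1 - C (X q) * Polynomial.X)).coeff (t - i) =
      ∑ p ∈ T, E p * X p * (X p ^ i * (∏ q ∈ T, (1 - C (X q) * Polynomial.X)).coeff (t - i)) := by
    intro i hi
    rw [hS i (by have := Finset.mem_range.1 hi; omega), Finset.sum_mul]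
    refine Finset.sum_congr rfl fun p _ => ?_
    ring
  rw [Finset.sum_congr rfl this, Finset.sum_comm]
  refine Finset.sum_congr rfl fun p hp => ?_
  rw [← Finset.mul_sum, sum_pow_mul_coeff_locator hp, coeff_C_mul]

variable [DecidableEq F]

/-- A zero discrepancy changes only the shift. Otherwise P is corrected by a shifted multiple of Q,
whose degree is at most shift + L₀ = r + 1 - len. If 2·len > r this fits in the old length; if not,
r + 1 - len becomes the new length and P takes the place of Q. -/
theorem BMInvariant.step {w k r : ℕ} {S : ℕ → F} {st : BMState F} {P Q : F[X]} {L₀ : ℕ}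
    (h : BMInvariant T E X r st P Q L₀) (hX : Set.InjOn X T) (hX0 : ∀ p ∈ T, X p ≠ 0)
    (hE : ∀ p ∈ T, E p ≠ 0) (hS : ∀ r < k, S r = ∑ p ∈ T, E p * X p ^ (r + 1)) (hr : r < k) :
    ∃ P' Q' L₀', BMInvariant T E X (r + 1) (bmStep w k S st r).val P' Q' L₀' := by
  have hs := h.shift_eq
  have hsp := h.shift_pos
  set d := discrepancy T E X P r with hd
  have hdisc : ∑ i ∈ Finset.range (st.len + 1), st.conn i * S (r - i) = d := by
    simp_rw [h.conn]
    exact sum_coeff_mul_syndrome hX0 hS h.natDegree_conn (by omega) hr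
  by_cases hd0 : d = 0
  · have hv : (bmStep w k S st r).val = { st with shift := st.shift + 1 } := by
      simp [bmStep, hdisc, hd0]
    rw [hv]
    refine ⟨P, Q, L₀, ?_⟩
    exact
      { h with
        shift_pos := by simp
        shift_eq := by simp only; omega
        generates := fun j h1 h2 => by
          rcases (Nat.lt_succ_iff.1 h2).lt_or_eq with h3 | rfl
          · exact h.generates j h1 h3
          · exact hd0 }
  · set P' := P - C (d * st.disc⁻¹) * (Polynomial.X ^ st.shift * Q) with hP'
    have hdeg : ∀ L, st.len ≤ L → r + 1 - st.len ≤ L → P'.natDegree ≤ L := by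
      intro L h1 h2
      refine (natDegree_sub_le _ _).trans (max_le (h.natDegree_conn.trans h1) ?_)
      refine (natDegree_C_mul_le _ _).trans (natDegree_mul_le.trans ?_)
      have := h.natDegree_prev
      rw [natDegree_X_pow]
      omega
    -- Cutting the array at k + 1 entries loses nothing, since both len and r + 1 - len are at most
    -- k.
    have hconn : ∀ i, (if i < k + 1 then (if st.shift ≤ i then
        st.conn i - d * st.disc⁻¹ * st.prev (i - st.shift) else st.conn i) else 0)
        = P'.coeff i := by
      intro i
      by_cases hi : i < k + 1
      · rw [if_pos hi, hP', coeff_sub, coeff_C_mul, coeff_X_pow_mul', h.conn, h.prev]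
        split_ifs <;> simp
      · rw [if_neg hi, coeff_eq_zero_of_natDegree_lt]
        exact lt_of_le_of_lt (hdeg k (by omega) (by omega)) (by omega)
    have hc0 : P'.coeff 0 = 1 := by
      rw [hP', coeff_sub, coeff_C_mul, coeff_X_pow_mul', if_neg (by omega), h.coeff_zero]; simp
    by_cases hg : 2 * st.len ≤ r
    · have hv : (bmStep w k S st r).val = ⟨fun i => P'.coeff i, st.conn, r + 1 - st.len, 1, d⟩ := by
        simp [bmStep, hdisc, hd0, hg, ← hconn]
      rw [hv]
      refine ⟨P', P, st.len, ?_⟩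
      exact
        { conn := fun i => rfl
          prev := h.conn
          coeff_zero := hc0
          natDegree_conn := hdeg (r + 1 - st.len) (by omega) le_rfl
          natDegree_prev := h.natDegree_conn
          shift_pos := le_rfl
          shift_eq := by simp only; omega
          disc_ne := hd0
          len_le := h.length_change_le hX hX0 hE hd0
          generates := fun j h1 h2 => by
            simp only at h1
            exact h.discrepancy_update hX0 j (by omega) (by omega) (by omega)
          generates_prev := by
            right
            simp only
            rw [show st.len + (r + 1 - st.len) - 1 = r by omega]
            exact ⟨rfl, h.generates⟩ }
    · have hv : (bmStep w k S st r).val =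
          { st with conn := fun i => P'.coeff i, shift := st.shift + 1 } := by
        simp [bmStep, hdisc, hd0, hg, ← hconn]
      rw [hv]
      refine ⟨P', Q, L₀, ?_⟩
      exact
        { h with
          conn := fun i => rfl
          coeff_zero := hc0
          natDegree_conn := hdeg st.len le_rfl (by omega)
          shift_pos := by simp
          shift_eq := by simp only; omega
          generates := fun j h1 h2 => by
            simp only at h1
            exact h.discrepancy_update hX0 j (by omega) (by omega) (by omega) }

/-- The Berlekamp–Massey algorithm finds the error locator polynomial. -/
theorem bmLocator_val {w k : ℕ} {S : ℕ → F} (hX : Set.InjOn X T) (hX0 : ∀ p ∈ T, X p ≠ 0)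
    (hE : ∀ p ∈ T, E p ≠ 0) (hS : ∀ r < k, S r = ∑ p ∈ T, E p * X p ^ (r + 1))
    (hk : 2 * T.card ≤ k) (i : ℕ) :
    (bmLocator w k S).val i = (∏ p ∈ T, (1 - C (X p) * Polynomial.X)).coeff i := by
  have h := Timed.loop_range_invariant (bmStep w k S)
    (fun r st => ∃ P Q L₀, BMInvariant T E X r st P Q L₀) k
    { conn := fun i : ℕ => if i = 0 then (1 : F) else 0
      prev := fun i : ℕ => if i = 0 then (1 : F) else 0, len := 0, shift := 1, disc := 1 }
    ⟨1, 1, 0, by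
      constructor <;> simp [coeff_one]⟩
    (fun r hr st ⟨P, Q, L₀, h⟩ => h.step hX hX0 hE hS hr)
  obtain ⟨P, Q, L₀, h⟩ := h
  rw [← eq_prod_of_eval_inv_eq_zero hX hX0 h.coeff_zero (h.natDegree_conn.trans h.len_le)]
  · exact h.conn i
  -- The length is at most |T|, so the discrepancies from |T| to 2|T| - 1 < k all vanish.
  · refine eval_inv_eq_zero_of_discrepancy hX hX0 hE P T.card fun j hj => ?_
    have := h.len_le
    exact h.generates _ (by omega) (by omega)

/-- Berlekamp–Massey decoding corrects up to `k / 2` errors. -/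
theorem bmDecode_val {w k n : ℕ} {α : F} {S : ℕ → F} {E : Fin n → F}
    (hα : orderOf α = n) (hn : 0 < n)
    (hS : ∀ r < k, S r = ∑ i, E i * α ^ ((i : ℕ) * (r + 1)))
    (hk : 2 * (Finset.univ.filter fun i => E i ≠ 0).card ≤ k) :
    (bmDecode w k n α S).val = E := by
  set T := Finset.univ.filter fun i => E i ≠ 0 with hT
  set X : Fin n → F := fun i => α ^ (i : ℕ) with hXdef
  have hα0 : α ≠ 0 := by
    rintro rfl
    have := pow_orderOf_eq_one (0 : F)
    rw [hα, zero_pow hn.ne'] at this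
    exact zero_ne_one this
  have hXinj : Function.Injective X := by
    intro i j hij
    exact Fin.ext (pow_injOn_Iio_orderOf (by simp [hα]) (by simp [hα]) hij)
  have hX : Set.InjOn X T := hXinj.injOn
  have hX0' : ∀ i, X i ≠ 0 := fun i => pow_ne_zero _ hα0
  have hX0 : ∀ p ∈ T, X p ≠ 0 := fun p _ => hX0' p
  have hE : ∀ p ∈ T, E p ≠ 0 := fun p hp => (Finset.mem_filter.1 hp).2
  have hS' : ∀ r < k, S r = ∑ p ∈ T, E p * X p ^ (r + 1) := by
    intro r hr
    rw [hS r hr, hT, Finset.sum_filter]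
    refine Finset.sum_congr rfl fun i _ => ?_
    split_ifs with h
    · rw [hXdef, pow_mul]
    · rw [not_not.1 h, zero_mul]
  set R : F[X] := ∏ p ∈ T, (1 - C (X p) * Polynomial.X) with hR
  set Ω : F[X] := ∑ p ∈ T, C (E p * X p) * ∏ q ∈ T.erase p, (1 - C (X q) * Polynomial.X) with hΩ
  have hloc : ∀ i, (bmLocator w k S).val i = R.coeff i := bmLocator_val hX hX0 hE hS' hk
  have hRdeg : R.natDegree ≤ T.card := natDegree_locator_le T X
  have hΩdeg : T.card ≠ 0 → Ω.natDegree < T.card := by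
    intro h0
    refine lt_of_le_of_lt (natDegree_sum_le_of_forall_le _ _ (n := T.card - 1) fun p hp => ?_)
      (by omega)
    refine (natDegree_C_mul_le _ _).trans ((natDegree_locator_le _ _).trans ?_)
    rw [Finset.card_erase_of_mem hp]
  funext i
  have hx : α⁻¹ ^ (i : ℕ) = (X i)⁻¹ := by rw [inv_pow]
  have hy : ∑ j ∈ Finset.range (k + 1), R.coeff j * (X i)⁻¹ ^ j = R.eval (X i)⁻¹ :=
    (eval_eq_sum_range' (by omega) _).symm
  have hev0 : ∀ i, eval (X i)⁻¹ R = ∏ p ∈ T, (1 - X p * (X i)⁻¹) := by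
    intro i; rw [hR, eval_prod]; simp
  have hroot : R.eval (X i)⁻¹ = 0 ↔ i ∈ T := by
    rw [hev0, Finset.prod_eq_zero_iff]
    constructor
    · rintro ⟨p, hp, h⟩
      have : X p = X i := by
        have h1 : X p * (X i)⁻¹ = 1 := (sub_eq_zero.1 h).symm
        rwa [mul_inv_eq_one₀ (hX0' i)] at h1
      rwa [← hXinj this]
    · exact fun h => ⟨i, h, by simp [hX0' i]⟩
  have hval : (bmDecode w k n α S).val i = if R.eval (X i)⁻¹ = 0 then
      -((∑ t ∈ Finset.range k, (if t < k then ∑ j ∈ Finset.range (t + 1), S j * R.coeff (t - j)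
          else 0) * (X i)⁻¹ ^ t) *
        (∑ t ∈ Finset.range k, (if t < k then ((t + 1 : ℕ) : F) * R.coeff (t + 1) else 0) *
          (X i)⁻¹ ^ t)⁻¹) else 0 := by
    simp only [bmDecode, Timed.val_bind, Timed.val_fill, Timed.val_fillPoly, Timed.val_fsum,
      Timed.val_fop, Timed.val_horner, Timed.val_fpow, Timed.val_ite, Timed.val_pure, hloc, hx, hy,
      decide_eq_true_eq]
  rw [hval]
  by_cases hi : i ∈ T
  · rw [if_pos (hroot.2 hi)]
    have hTpos : 0 < T.card := Finset.card_pos.2 ⟨i, hi⟩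
    have h1 : ∑ t ∈ Finset.range k, (if t < k then ∑ j ∈ Finset.range (t + 1),
        S j * R.coeff (t - j) else 0) * (X i)⁻¹ ^ t = Ω.eval (X i)⁻¹ := by
      rw [eval_eq_sum_range' (show Ω.natDegree < k by have := hΩdeg hTpos.ne'; omega)]
      refine Finset.sum_congr rfl fun t ht => ?_
      have ht' := Finset.mem_range.1 ht
      rw [if_pos ht', sum_syndrome_mul_coeff_locator hS' ht']
    have h2 : ∑ t ∈ Finset.range k, (if t < k then ((t + 1 : ℕ) : F) * R.coeff (t + 1) else 0) *
        (X i)⁻¹ ^ t = (derivative R).eval (X i)⁻¹ := by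
      rw [eval_eq_sum_range' (show (derivative R).natDegree < k by
        have := natDegree_derivative_le R; omega)]
      refine Finset.sum_congr rfl fun t ht => ?_
      rw [if_pos (Finset.mem_range.1 ht), coeff_derivative]
      push_cast; ring
    set G := ∏ q ∈ T.erase i, (1 - X q * (X i)⁻¹) with hG
    have hG0 : G ≠ 0 := by
      refine Finset.prod_ne_zero_iff.2 fun q hq e => ?_
      have hq' := Finset.mem_erase.1 hq
      have h1 : X q * (X i)⁻¹ = 1 := (sub_eq_zero.1 e).symm
      rw [mul_inv_eq_one₀ (hX0' i)] at h1
      exact hq'.1 (hXinj h1)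
    -- Every other summand of Ω contains the factor 1 - X(i)x, which vanishes here; likewise only
    -- one term of the product rule survives in `h4`. The quotient is -E(i), and the decoder negates
    -- it.
    have h3 : Ω.eval (X i)⁻¹ = E i * X i * G := by
      rw [hΩ, eval_finsetSum, Finset.sum_eq_single i]
      · simp [eval_prod, hG]
      · intro p hp hpi
        rw [eval_mul, eval_prod, Finset.prod_eq_zero (Finset.mem_erase.2 ⟨hpi.symm, hi⟩), mul_zero]
        simp [hX0' i]
      · exact fun h => absurd hi h
    have h4 : (derivative R).eval (X i)⁻¹ = - (X i * G) := by
      have : R = (1 - C (X i) * Polynomial.X) *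
          ∏ q ∈ T.erase i, (1 - C (X q) * Polynomial.X) := (Finset.mul_prod_erase _ _ hi).symm
      rw [this, derivative_mul]
      simp [eval_prod, hG, hX0' i]
    rw [h1, h2, h3, h4, inv_neg, mul_neg, neg_neg]
    field_simp [hX0' i, hG0]
  · rw [if_neg fun h => hi (hroot.1 h)]
    by_contra h
    exact hi (Finset.mem_filter.2 ⟨Finset.mem_univ _, Ne.symm h⟩)

end BerlekampMassey

end QZ
namespace QZ

/-! ## The field with four elements -/

section FieldFour

variable {K : Type} [Field K]

theorem add_self_of_algebra [Algebra (ZMod 2) K] (x : K) : x + x = 0 := by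
  have : CharP K 2 := charP_of_injective_algebraMap (algebraMap (ZMod 2) K).injective 2
  exact CharTwo.add_self_eq_zero x

theorem add_sq_of_algebra [Algebra (ZMod 2) K] (x y : K) : (x + y) ^ 2 = x ^ 2 + y ^ 2 := by
  linear_combination (x * y) * add_self_of_algebra (1 : K)

theorem omega_ne_zero {ω : K} (hω : ω ^ 2 = ω + 1) : ω ≠ 0 := by
  rintro rfl
  simp at hω

theorem omega_ne_one [Algebra (ZMod 2) K] {ω : K} (hω : ω ^ 2 = ω + 1) : ω ≠ 1 := by
  rintro rfl
  rw [add_self_of_algebra] at hω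
  simp at hω

/-- Every element is a root of X⁴ - X, which splits as X(X - 1)(X - ω)(X - ω²) in characteristic 2.
-/
theorem eq_zero_or_one_or_omega [Algebra (ZMod 2) K] {ω : K} (hK : Nat.card K = 4)
    (hω : ω ^ 2 = ω + 1) (x : K) : x = 0 ∨ x = 1 ∨ x = ω ∨ x = ω ^ 2 := by
  have : Finite K := Nat.finite_of_card_ne_zero (by omega)
  have := Fintype.ofFinite K
  have h4 : x ^ 4 = x := by
    have := FiniteField.pow_card x
    rwa [← Nat.card_eq_fintype_card, hK] at this
  have h2 : (2 : K) = 0 := by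
    have := add_self_of_algebra (1 : K)
    rwa [one_add_one_eq_two] at this
  have h : x * ((x - 1) * ((x - ω) * (x - ω ^ 2))) = 0 := by
    linear_combination h4 + x * (x - 1) * (-x + ω + 1) * hω + x * (x - 1) * (-x - ω * x + ω) * h2
  simpa [sub_eq_zero] using h

/-- The expression is the trace of xy² to the prime field, so one bit records it completely. -/
theorem mul_sq_add_sq_mul_eq [Algebra (ZMod 2) K] {ω : K} (hK : Nat.card K = 4)
    (hω : ω ^ 2 = ω + 1) (x y : K) : x * y ^ 2 + x ^ 2 * y = 0 ∨ x * y ^ 2 + x ^ 2 * y = 1 := by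
  have h2 : (2 : K) = 0 := by
    have := add_self_of_algebra (1 : K)
    rwa [one_add_one_eq_two] at this
  rcases eq_zero_or_one_or_omega hK hω x with rfl | rfl | rfl | rfl <;>
  rcases eq_zero_or_one_or_omega hK hω y with rfl | rfl | rfl | rfl <;>
  grind

end FieldFour

section TraceInner

variable {K ι : Type} [Field K] [Fintype ι]

theorem traceInner_comm (u v : ι → K) : traceInner u v = traceInner v u :=
  Finset.sum_congr rfl fun i _ => by ring

@[simp] theorem traceInner_zero_right (u : ι → K) : traceInner u 0 = 0 := by simp [traceInner]

@[simp] theorem traceInner_zero_left (u : ι → K) : traceInner 0 u = 0 := by simp [traceInner]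

variable [Algebra (ZMod 2) K]

theorem traceInner_add_left (u v w : ι → K) :
    traceInner (u + v) w = traceInner u w + traceInner v w := by
  simp only [traceInner, ← Finset.sum_add_distrib, Pi.add_apply, add_sq_of_algebra]
  exact Finset.sum_congr rfl fun i _ => by ring

theorem traceInner_add_right (u v w : ι → K) :
    traceInner u (v + w) = traceInner u v + traceInner u w := by
  simp only [traceInner_comm u, traceInner_add_left]

theorem traceInner_eq_zero_or_one {ω : K} (hK : Nat.card K = 4) (hω : ω ^ 2 = ω + 1)
    (u v : ι → K) : traceInner u v = 0 ∨ traceInner u v = 1 := by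
  refine Finset.sum_induction _ (fun t => t = 0 ∨ t = 1) ?_ (Or.inl rfl)
    fun i _ => mul_sq_add_sq_mul_eq hK hω _ _
  rintro a b (rfl | rfl) (rfl | rfl) <;> simp [add_self_of_algebra]

end TraceInner

/-! ## Correctness of the exhaustive search -/

section Exhaustive

variable {K : Type} [Field K] [DecidableEq K]

/-- The syndrome of a vector with respect to given generators. -/
def syndrome {l s : ℕ} (g : Fin s → Fin l → K) (e : Fin l → K) : Fin s → Bool :=
  fun j => decide (traceInner e (g j) ≠ 0)

omit [DecidableEq K] in
theorem mem_allVectors {ω : K} (h : ∀ x : K, x = 0 ∨ x = 1 ∨ x = ω ∨ x = ω ^ 2) :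
    ∀ {l : ℕ} (e : Fin l → K), e ∈ allVectors ω l
  | 0, e => by
    rw [allVectors, List.mem_singleton]
    exact Subsingleton.elim _ _
  | l + 1, e => by
    rw [allVectors, List.mem_flatMap]
    exact ⟨e 0, by simpa using h (e 0), List.mem_map.2 ⟨Fin.tail e, mem_allVectors h _,
      Fin.cons_self_tail e⟩⟩

theorem foldl_finRange_add {M : Type} [AddCommMonoid M] {l : ℕ} (f : Fin l → M) :
    (List.finRange l).foldl (fun acc i => acc + f i) 0 = ∑ i, f i := by
  rw [Fin.sum_univ_def, List.sum_eq_foldl, List.foldl_map]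

theorem innerBit_val {l : ℕ} (u v : Fin l → K) :
    (innerBit u v).val = decide (traceInner u v ≠ 0) := by
  simp only [innerBit, Timed.val_bind, Timed.val_op, Timed.val_loop, foldl_finRange_add]
  rfl

theorem weightOf_val {l : ℕ} (u : Fin l → K) : (weightOf u).val = hammingNorm u := by
  have : (weightOf u).val = (List.finRange l).foldl
      (fun acc i => acc + if u i ≠ 0 then 1 else 0) 0 := by
    simp only [weightOf, Timed.val_bind, Timed.val_op, Timed.val_loop, Timed.val_ite,
      Timed.val_pure, decide_eq_true_eq]
    congr 1
    funext acc i
    split_ifs <;> simp_all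
  rw [this, foldl_finRange_add, hammingNorm, Finset.card_filter]

theorem bitsEqual_val {s : ℕ} (a c : Fin s → Bool) : (bitsEqual a c).val = decide (a = c) := by
  simp only [bitsEqual, Timed.val_loop, Timed.val_op]
  have : ∀ (l : List (Fin s)) (b : Bool), l.foldl (fun acc i => acc && (a i == c i)) b =
      (b && decide (∀ i ∈ l, a i = c i)) := by
    intro l
    induction l with
    | nil => simp
    | cons x xs ih =>
      intro b
      rw [List.foldl_cons, ih, Bool.eq_iff_iff]
      simp [and_assoc]
  rw [this, Bool.eq_iff_iff]
  simp [funext_iff]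

/-- The invariant depends on the set of items already seen, which suits a search whose outcome is a
statement about all candidates. -/
theorem Timed.loop_list_invariant {α β : Type} (body : α → β → Timed α) (P : Set β → α → Prop)
    (hstep : ∀ A a x, P A a → P (insert x A) (body a x).val) (l : List β) :
    ∀ (A : Set β) (a : α), P A a → P ({x | x ∈ l} ∪ A) (Timed.loop body l a).val := by
  induction l with
  | nil => intro A a h; simpa [Timed.loop] using h
  | cons x xs ih =>
    intro A a h
    have := ih _ _ (hstep A a x h)
    have hset : ({y | y ∈ x :: xs} ∪ A : Set β) = {y | y ∈ xs} ∪ insert x A := by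
      ext y; simp; tauto
    rw [hset]
    exact this

/-- Exhaustive search finds a vector of least weight with the given syndrome. -/
theorem exhaustiveSearch_val {ω : K} (h : ∀ x : K, x = 0 ∨ x = 1 ∨ x = ω ∨ x = ω ^ 2) {l s : ℕ}
    (g : Fin s → Fin l → K) (e : Fin l → K) :
    syndrome g (exhaustiveSearch ω g (syndrome g e)).val = syndrome g e ∧
      hammingNorm (exhaustiveSearch ω g (syndrome g e)).val ≤ hammingNorm e := by
  set σ := syndrome g e with hσ
  set body : Option (ℕ × (Fin l → K)) → (Fin l → K) → Timed (Option (ℕ × (Fin l → K))) :=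
    fun best e => do
      let cand ← Timed.fill (fun i => Timed.op (e i))
      let syn ← Timed.fill (fun j => innerBit cand (g j))
      let same ← bitsEqual syn σ
      if same then
        let wt ← weightOf cand
        match best with
        | none => Timed.op (some (wt, cand))
        | some (wt', e') => Timed.op (if wt < wt' then some (wt, cand) else some (wt', e'))
      else
        return best with hbody
  have hsyn : ∀ x : Fin l → K, (fun j => (innerBit x (g j)).val) = syndrome g x := fun x => by
    funext j; rw [innerBit_val]; rfl
  have hval : ∀ best x, (body best x).val = if syndrome g x = σ then
      (match best with
        | none => some (hammingNorm x, x)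
        | some (wt', e') =>
          if hammingNorm x < wt' then some (hammingNorm x, x) else some (wt', e')) else best := by
    intro best x
    simp only [hbody, Timed.val_bind, Timed.val_fill, Timed.val_op, Timed.val_ite, bitsEqual_val,
      decide_eq_true_eq, hsyn, Timed.val_pure, weightOf_val]
    rcases best with _ | ⟨wt', e'⟩ <;> rfl
  -- Either no candidate seen so far matches, or the stored one matches, carries its true weight,
  -- and is no heavier than any match seen.
  have hinv := Timed.loop_list_invariant body
    (fun A best => (best = none → ∀ x ∈ A, syndrome g x ≠ σ) ∧ ∀ wt e', best = some (wt, e') →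
      wt = hammingNorm e' ∧ syndrome g e' = σ ∧ ∀ x ∈ A, syndrome g x = σ → wt ≤ hammingNorm x)
    (by
      rintro A best x ⟨h1, h2⟩
      rw [hval]
      by_cases hx : syndrome g x = σ
      · rw [if_pos hx]
        rcases best with _ | ⟨wt', e'⟩
        · refine ⟨by simp, ?_⟩
          intro wt e'' he
          simp only [Option.some.injEq, Prod.mk.injEq] at he
          obtain ⟨rfl, rfl⟩ := he
          refine ⟨rfl, hx, ?_⟩
          rintro y (rfl | hy) hyσ
          · exact le_rfl
          · exact absurd hyσ (h1 rfl y hy)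
        · obtain ⟨h3, h4, h5⟩ := h2 wt' e' rfl
          simp only
          split_ifs with hlt
          · refine ⟨by simp, ?_⟩
            intro wt e'' he
            simp only [Option.some.injEq, Prod.mk.injEq] at he
            obtain ⟨rfl, rfl⟩ := he
            refine ⟨rfl, hx, ?_⟩
            rintro y (rfl | hy) hyσ
            · exact le_rfl
            · exact hlt.le.trans (h5 y hy hyσ)
          · refine ⟨by simp, ?_⟩
            intro wt e'' he
            simp only [Option.some.injEq, Prod.mk.injEq] at he
            obtain ⟨rfl, rfl⟩ := he
            refine ⟨h3, h4, ?_⟩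
            rintro y (rfl | hy) hyσ
            · exact not_lt.1 hlt
            · exact h5 y hy hyσ
      · rw [if_neg hx]
        refine ⟨fun hb => ?_, fun wt e' he => ?_⟩
        · rintro y (rfl | hy)
          · exact hx
          · exact h1 hb y hy
        · obtain ⟨h3, h4, h5⟩ := h2 wt e' he
          refine ⟨h3, h4, ?_⟩
          rintro y (rfl | hy) hyσ
          · exact absurd hyσ hx
          · exact h5 y hy hyσ)
    (allVectors ω l) ∅ none ⟨by simp, by simp⟩
  have hres : (exhaustiveSearch ω g σ).val =
      match (Timed.loop body (allVectors ω l) none).val with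
      | none => fun _ => 0
      | some (_, e) => e := by
    simp only [exhaustiveSearch, Timed.val_bind]
    rcases (Timed.loop body (allVectors ω l) none).val with _ | ⟨_, _⟩ <;> rfl
  rcases hbest : (Timed.loop body (allVectors ω l) none).val with _ | ⟨wt, e'⟩
  · rw [hbest] at hinv
    -- The vector that produced the syndrome is itself enumerated, so the search cannot come back
    -- empty.
    exact absurd rfl (hinv.1 rfl e (Or.inl (mem_allVectors h e)))
  · rw [hbest] at hinv
    obtain ⟨h3, h4, h5⟩ := hinv.2 wt e' rfl
    rw [hres, hbest]
    exact ⟨h4, h3 ▸ h5 e (Or.inl (mem_allVectors h e)) rfl⟩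

end Exhaustive

end QZ
namespace QZ

/-! ## Pauli operators -/

section Pauli

variable {K ι : Type} [Field K] [DecidableEq K] [Fintype ι] [DecidableEq ι]

variable [Algebra (ZMod 2) K] {ω : K}

theorem sign_mul_sign (b c : Bool) : sign b * sign c = sign (xor b c) := by
  cases b <;> cases c <;> simp [sign]

theorem pauli1_values (hω : ω ^ 2 = ω + 1) : pauli1 ω 0 = 1 ∧
    pauli1 ω ω = !![0, 1; 1, 0] ∧ pauli1 ω 1 = !![0, -Complex.I; Complex.I, 0] ∧
    pauli1 ω (ω ^ 2) = !![1, 0; 0, -1] := by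
  have h0 := omega_ne_zero hω
  have h1 := omega_ne_one hω
  have h2 : ω ^ 2 ≠ ω := by rw [hω]; simp
  have h3 : ω ^ 2 ≠ 1 := by rw [hω]; simpa using h0
  refine ⟨by simp [pauli1], by simp [pauli1, h0], by simp [pauli1, h1.symm], ?_⟩
  rw [pauli1, if_neg (pow_ne_zero 2 h0), if_neg h2, if_neg h3]

theorem pauli1_mul (hK : Nat.card K = 4) (hω : ω ^ 2 = ω + 1) (x y : K) :
    ∃ z : ℂ, pauli1 ω x * pauli1 ω y = z • pauli1 ω (x + y) := by
  obtain ⟨p0, pω, p1, p2⟩ := pauli1_values hω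
  have s := fun x : K => add_self_of_algebra x
  have e1 : 1 + ω = ω ^ 2 := by rw [hω, add_comm]
  have e2 : ω + 1 = ω ^ 2 := hω.symm
  have e3 : ω + ω ^ 2 = 1 := by linear_combination hω + s ω
  have e4 : ω ^ 2 + ω = 1 := by linear_combination hω + s ω
  have e5 : 1 + ω ^ 2 = ω := by linear_combination hω + s 1
  have e6 : ω ^ 2 + 1 = ω := by linear_combination hω + s 1
  rcases eq_zero_or_one_or_omega hK hω x with rfl | rfl | rfl | rfl
  · exact ⟨1, by simp [p0]⟩
  · rcases eq_zero_or_one_or_omega hK hω y with rfl | rfl | rfl | rfl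
    · exact ⟨1, by simp [p0]⟩
    · exact ⟨1, by rw [s, p1, p0]; ext i j; fin_cases i <;> fin_cases j <;> simp⟩
    · exact ⟨-Complex.I, by rw [e1, p1, pω, p2]; ext i j; fin_cases i <;> fin_cases j <;> simp⟩
    · exact ⟨Complex.I, by rw [e5, p1, pω, p2]; ext i j; fin_cases i <;> fin_cases j <;> simp⟩
  · rcases eq_zero_or_one_or_omega hK hω y with rfl | rfl | rfl | rfl
    · exact ⟨1, by simp [p0]⟩
    · exact ⟨Complex.I, by rw [e2, p1, pω, p2]; ext i j; fin_cases i <;> fin_cases j <;> simp⟩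
    · exact ⟨1, by rw [s, pω, p0]; ext i j; fin_cases i <;> fin_cases j <;> simp⟩
    · exact ⟨-Complex.I, by rw [e3, p1, pω, p2]; ext i j; fin_cases i <;> fin_cases j <;> simp⟩
  · rcases eq_zero_or_one_or_omega hK hω y with rfl | rfl | rfl | rfl
    · exact ⟨1, by simp [p0]⟩
    · exact ⟨-Complex.I, by rw [e6, p1, pω, p2]; ext i j; fin_cases i <;> fin_cases j <;> simp⟩
    · exact ⟨Complex.I, by rw [e4, p1, pω, p2]; ext i j; fin_cases i <;> fin_cases j <;> simp⟩
    · exact ⟨1, by rw [s, p2, p0]; ext i j; fin_cases i <;> fin_cases j <;> simp⟩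

/-- Distinct non-identity Pauli matrices anticommute, and the trace form takes the value 1 exactly
on pairs of distinct nonzero elements. -/
theorem pauli1_comm (hK : Nat.card K = 4) (hω : ω ^ 2 = ω + 1) (x y : K) :
    pauli1 ω x * pauli1 ω y =
      sign (decide (x * y ^ 2 + x ^ 2 * y ≠ 0)) • (pauli1 ω y * pauli1 ω x) := by
  obtain ⟨p0, pω, p1, p2⟩ := pauli1_values hω
  have s := fun x : K => add_self_of_algebra x
  have c0 : ∀ x : K, x * x ^ 2 + x ^ 2 * x = 0 := fun x => by linear_combination s (x ^ 3)
  have d1 : (1 : K) * ω ^ 2 + 1 ^ 2 * ω ≠ 0 := by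
    rw [show (1 : K) * ω ^ 2 + 1 ^ 2 * ω = 1 by linear_combination hω + s ω]; exact one_ne_zero
  have d2 : (1 : K) * (ω ^ 2) ^ 2 + 1 ^ 2 * ω ^ 2 ≠ 0 := by
    rw [show (1 : K) * (ω ^ 2) ^ 2 + 1 ^ 2 * ω ^ 2 = 1 by
      linear_combination (ω ^ 2 + ω + 3) * hω + s 1 + s (2 * ω)]
    exact one_ne_zero
  have d3 : ω * (ω ^ 2) ^ 2 + ω ^ 2 * ω ^ 2 ≠ 0 := by
    rw [show ω * (ω ^ 2) ^ 2 + ω ^ 2 * ω ^ 2 = 1 by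
      linear_combination (ω ^ 3 + 2 * ω ^ 2 + 3 * ω + 5) * hω + s (4 * ω) + s 2]
    exact one_ne_zero
  have sw : ∀ x y : K, y * x ^ 2 + y ^ 2 * x = x * y ^ 2 + x ^ 2 * y := fun x y => by ring
  rcases eq_zero_or_one_or_omega hK hω x with rfl | rfl | rfl | rfl <;>
  rcases eq_zero_or_one_or_omega hK hω y with rfl | rfl | rfl | rfl
  all_goals first
    | (rw [c0]; simp [sign]; done)
    | (simp [sign, p0]; done)
    | skip
  · rw [decide_eq_true d1, p1, pω]; ext i j; fin_cases i <;> fin_cases j <;> simp [sign]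
  · rw [decide_eq_true d2, p1, p2]; ext i j; fin_cases i <;> fin_cases j <;> simp [sign]
  · rw [sw, decide_eq_true d1, p1, pω]; ext i j; fin_cases i <;> fin_cases j <;> simp [sign]
  · rw [decide_eq_true d3, pω, p2]; ext i j; fin_cases i <;> fin_cases j <;> simp [sign]
  · rw [sw, decide_eq_true d2, p1, p2]; ext i j; fin_cases i <;> fin_cases j <;> simp [sign]
  · rw [sw, decide_eq_true d3, pω, p2]; ext i j; fin_cases i <;> fin_cases j <;> simp [sign]

omit [Algebra (ZMod 2) K] in
theorem pauli_mul_apply (u v : ι → K) (x y : ι → Fin 2) :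
    (pauli ω u * pauli ω v) x y = ∏ q, (pauli1 ω (u q) * pauli1 ω (v q)) (x q) (y q) := by
  simp only [Matrix.mul_apply, pauli, Matrix.of_apply]
  rw [Finset.prod_univ_sum, Fintype.piFinset_univ]
  exact Finset.sum_congr rfl fun z _ => Finset.prod_mul_distrib.symm

theorem pauli_mul (hK : Nat.card K = 4) (hω : ω ^ 2 = ω + 1) (u v : ι → K) :
    ∃ z : ℂ, pauli ω u * pauli ω v = z • pauli ω (u + v) := by
  choose z hz using pauli1_mul hK hω
  refine ⟨∏ q, z (u q) (v q), ?_⟩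
  ext x y
  rw [pauli_mul_apply, Matrix.smul_apply]
  simp [hz, pauli, Finset.prod_mul_distrib]

/-- In characteristic 2 the sign turns sums of zeros and ones into products; this assembles the
one-qubit commutation signs into that of the tensor product. -/
theorem prod_sign {κ : Type} (s : Finset κ) (t : κ → K) (ht : ∀ i, t i = 0 ∨ t i = 1) :
    ∏ i ∈ s, sign (decide (t i ≠ 0)) = sign (decide (∑ i ∈ s, t i ≠ 0)) := by
  classical
  have h01 : ∀ s : Finset κ, ∑ i ∈ s, t i = 0 ∨ ∑ i ∈ s, t i = 1 := fun s =>
    Finset.sum_induction _ (fun t => t = 0 ∨ t = 1)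
      (by rintro a b (rfl | rfl) (rfl | rfl) <;> simp [add_self_of_algebra]) (Or.inl rfl)
      fun i _ => ht i
  induction s using Finset.induction_on with
  | empty => simp [sign]
  | insert a s ha ih =>
    rw [Finset.prod_insert ha, Finset.sum_insert ha, ih]
    rcases ht a with h1 | h1 <;> rcases h01 s with h2 | h2 <;>
      rw [h1, h2] <;> simp [sign, add_self_of_algebra]

theorem pauli_comm (hK : Nat.card K = 4) (hω : ω ^ 2 = ω + 1) (u v : ι → K) :
    pauli ω u * pauli ω v = sign (decide (traceInner u v ≠ 0)) • (pauli ω v * pauli ω u) := by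
  ext x y
  rw [Matrix.smul_apply, pauli_mul_apply, pauli_mul_apply, traceInner, ← prod_sign _ _
    fun i => mul_sq_add_sq_mul_eq hK hω (u i) (v i), smul_eq_mul, ← Finset.prod_mul_distrib]
  refine Finset.prod_congr rfl fun q _ => ?_
  rw [pauli1_comm hK hω, Matrix.smul_apply, smul_eq_mul]

end Pauli

/-! ## Symbolic runs on Pauli errors -/

namespace QProg

variable {K ι α β : Type} [Field K] [DecidableEq K] [Fintype ι] [DecidableEq ι]

/-- The program measures only elements of `S`. -/
def MeasuresIn (S : Set (ι → K)) : QProg K ι α → Prop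
  | ret _ => True
  | work _ p => MeasuresIn S p
  | gate _ _ p => MeasuresIn S p
  | measure g next => g ∈ S ∧ ∀ o, MeasuresIn S (next o)

/-- The result of a program that measures stabilizer elements on a state of the code that was hit
by the Pauli error `e`, and the error afterwards. -/
def sim (χ : (ι → K) → Bool) : QProg K ι α → (ι → K) → α × (ι → K)
  | ret a, e => (a, e)
  | work _ p, e => sim χ p e
  | gate q x p, e => sim χ p (e + Pi.single q x)
  | measure g next, e => sim χ (next (xor (χ g) (decide (traceInner g e ≠ 0)))) e

/-- Every branch ends in a state of `W`. -/
def EndsIn (ω : K) (W : Submodule ℂ (State ι)) (p : QProg K ι α) (φ : State ι) : Prop :=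
  ∀ B ∈ run ω p φ, B.state ∈ W

variable {ω : K} {W : Submodule ℂ (State ι)}

theorem endsIn_ret (a : α) (φ : State ι) :
    EndsIn ω W (ret a : QProg K ι α) φ ↔ φ ∈ W := by
  simp [EndsIn, run]

theorem endsIn_work (c : ℕ) (p : QProg K ι α) (φ : State ι) :
    EndsIn ω W (work c p) φ ↔ EndsIn ω W p φ := by
  simp [EndsIn, run]

theorem endsIn_gate (q : ι) (x : K) (p : QProg K ι α) (φ : State ι) :
    EndsIn ω W (gate q x p) φ ↔ EndsIn ω W p (pauli ω (Pi.single q x) *ᵥ φ) := by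
  simp [EndsIn, run]

theorem endsIn_measure (g : ι → K) (next : Bool → QProg K ι α) (φ : State ι) :
    EndsIn ω W (measure g next) φ ↔
      ∀ o, EndsIn ω W (next o) ((2⁻¹ : ℂ) • (φ + sign o • (pauli ω g *ᵥ φ))) := by
  simp only [EndsIn, run, List.mem_map, List.mem_flatMap]
  constructor
  · intro h o B hB
    have := h ⟨B.result, B.state, B.steps + (hammingNorm g + 4)⟩
      ⟨B, ⟨o, by cases o <;> simp, hB⟩, rfl⟩
    exact this
  · rintro h _ ⟨B, ⟨o, -, hB⟩, rfl⟩
    exact h o B hB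

/-- The control flow depends on the state only through the outcomes, so each fixed outcome sequence
is a linear map. This is what extends correction from Pauli errors to their span. -/
theorem EndsIn.add {p : QProg K ι α} {φ₁ φ₂ : State ι} (h₁ : EndsIn ω W p φ₁)
    (h₂ : EndsIn ω W p φ₂) : EndsIn ω W p (φ₁ + φ₂) := by
  induction p generalizing φ₁ φ₂ with
  | ret a =>
    rw [endsIn_ret] at *
    exact W.add_mem h₁ h₂
  | work c p ih =>
    rw [endsIn_work] at *
    exact ih h₁ h₂
  | gate q x p ih =>
    rw [endsIn_gate] at *
    rw [Matrix.mulVec_add]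
    exact ih h₁ h₂
  | measure g next ih =>
    rw [endsIn_measure] at *
    intro o
    convert ih o (h₁ o) (h₂ o) using 1
    rw [Matrix.mulVec_add]
    module

theorem EndsIn.smul {p : QProg K ι α} {φ : State ι} (z : ℂ) (h : EndsIn ω W p φ) :
    EndsIn ω W p (z • φ) := by
  induction p generalizing φ with
  | ret a =>
    rw [endsIn_ret] at *
    exact W.smul_mem z h
  | work c p ih =>
    rw [endsIn_work] at *
    exact ih h
  | gate q x p ih =>
    rw [endsIn_gate] at *
    rw [Matrix.mulVec_smul]
    exact ih h
  | measure g next ih =>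
    rw [endsIn_measure] at *
    intro o
    convert ih o (h o) using 1
    rw [Matrix.mulVec_smul]
    module

/-- Needed for outcomes of probability zero, which still occur as branches, with state 0. -/
theorem endsIn_zero (p : QProg K ι α) : EndsIn ω W p 0 := by
  induction p with
  | ret a => exact (endsIn_ret _ _).2 W.zero_mem
  | work c p ih => exact (endsIn_work _ _ _).2 ih
  | gate q x p ih =>
    rw [endsIn_gate, Matrix.mulVec_zero]
    exact ih
  | measure g next ih =>
    rw [endsIn_measure]
    intro o
    simpa using ih o

variable [Algebra (ZMod 2) K]

/-- On a state of the code hit by a Pauli error, every branch of a program that measures only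
stabilizer elements follows the symbolic run. -/
theorem endsIn_of_sim (hK : Nat.card K = 4) (hω : ω ^ 2 = ω + 1) {S : Set (ι → K)}
    {χ : (ι → K) → Bool} {ψ : State ι} (hψ : ψ ∈ codeSpace ω S χ) {p : QProg K ι α}
    (hp : MeasuresIn S p) (e : ι → K) (hW : pauli ω (sim χ p e).2 *ᵥ ψ ∈ W) :
    EndsIn ω W p (pauli ω e *ᵥ ψ) := by
  induction p generalizing e with
  | ret a => exact (endsIn_ret _ _).2 hW
  | work c p ih => exact (endsIn_work _ _ _).2 (ih hp e hW)
  | gate q x p ih =>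
    rw [endsIn_gate, Matrix.mulVec_mulVec]
    obtain ⟨z, hz⟩ := pauli_mul hK hω (Pi.single q x) e
    rw [hz, Matrix.smul_mulVec, add_comm]
    exact (ih hp _ hW).smul z
  | measure g next ih =>
    rw [endsIn_measure]
    intro o
    have hg : pauli ω g *ᵥ (pauli ω e *ᵥ ψ) =
        sign (xor (χ g) (decide (traceInner g e ≠ 0))) • (pauli ω e *ᵥ ψ) := by
      rw [Matrix.mulVec_mulVec, pauli_comm hK hω, Matrix.smul_mulVec, ← Matrix.mulVec_mulVec,
        hψ g hp.1, Matrix.mulVec_smul, smul_smul, sign_mul_sign, Bool.xor_comm]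
    rw [hg, smul_smul, sign_mul_sign]
    -- The hit state is an eigenvector of the measured operator: the predicted outcome projects it
    -- to itself, the other one to zero.
    by_cases ho : o = xor (χ g) (decide (traceInner g e ≠ 0))
    · rw [ho, Bool.xor_self]
      convert (ih _ (hp.2 _) e hW) using 1
      simp only [sign, Bool.false_eq_true, if_false]
      module
    · have : xor o (xor (χ g) (decide (traceInner g e ≠ 0))) = true := by
        generalize xor (χ g) (decide (traceInner g e ≠ 0)) = c at ho
        cases o <;> cases c <;> simp_all
      rw [this]
      convert endsIn_zero (next o) using 1
      simp [sign]

/-- A program that measures only stabilizer elements and takes the Pauli errors on at most `t`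
qubits to stabilizer elements corrects all errors on at most `t` qubits. -/
theorem endsIn_span_of_sim (hK : Nat.card K = 4) (hω : ω ^ 2 = ω + 1) {S : Set (ι → K)}
    {χ : (ι → K) → Bool} {ψ : State ι} (hψ : ψ ∈ codeSpace ω S χ) {p : QProg K ι α}
    (hp : MeasuresIn S p) {t : ℝ} (h : ∀ e : ι → K, (hammingNorm e : ℝ) ≤ t → (sim χ p e).2 ∈ S)
    {E : Matrix (ι → Fin 2) (ι → Fin 2) ℂ} (hE : E ∈ errorSpace ω ι t) :
    EndsIn ω (ℂ ∙ ψ) p (E *ᵥ ψ) := by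
  induction hE using Submodule.span_induction with
  | mem A hA =>
    obtain ⟨e, he, rfl⟩ := hA
    refine endsIn_of_sim hK hω hψ hp e ?_
    -- The remaining error is a stabilizer element and acts on ψ as a sign.
    rw [hψ _ (h e he)]
    exact Submodule.smul_mem _ _ (Submodule.mem_span_singleton_self ψ)
  | zero => rw [Matrix.zero_mulVec]; exact endsIn_zero p
  | add A B _ _ hA hB => rw [Matrix.add_mulVec]; exact hA.add hB
  | smul z A _ hA => rw [Matrix.smul_mulVec]; exact hA.smul z

end QProg

end QZ
namespace QZ

/-! ## Linear algebra of the trace inner product -/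

section TraceDual

variable {K : Type} [Field K] [Algebra (ZMod 2) K] {ω : K}

theorem exists_smul_omega_add (hK : Nat.card K = 4) (hω : ω ^ 2 = ω + 1) {ι : Type} (w : ι → K) :
    ∃ x y : ι → ZMod 2, w = fun j => x j • ω + y j • ω ^ 2 := by
  have : ∀ j, ∃ a b : ZMod 2, w j = a • ω + b • ω ^ 2 := by
    intro j
    rcases eq_zero_or_one_or_omega hK hω (w j) with h | h | h | h
    · exact ⟨0, 0, by simp [h]⟩
    · refine ⟨1, 1, ?_⟩
      rw [h, one_smul, one_smul]
      linear_combination -hω - add_self_of_algebra ω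
    · exact ⟨1, 0, by simp [h]⟩
    · exact ⟨0, 1, by simp [h]⟩
  choose x y h using this
  exact ⟨x, y, funext h⟩

theorem zmod_two_cases (a : ZMod 2) : a = 0 ∨ a = 1 := by
  revert a; decide

/-- The form vanishes on (ω, ω) and equals 1 on (ω, ω̄), which is why each CSS half detects the
opposite part of an error. -/
theorem traceInner_smul_omega (hω : ω ^ 2 = ω + 1) {ι : Type} [Fintype ι] (a x y : ι → ZMod 2) :
    traceInner (fun j => a j • ω) (fun j => x j • ω + y j • ω ^ 2) =
      algebraMap (ZMod 2) K (∑ j, a j * y j) := by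
  have h2 : (2 : K) = 0 := by
    have := add_self_of_algebra (1 : K)
    rwa [one_add_one_eq_two] at this
  rw [traceInner, map_sum]
  refine Finset.sum_congr rfl fun j _ => ?_
  rcases zmod_two_cases (a j) with ha | ha <;> rcases zmod_two_cases (x j) with hx | hx <;>
    rcases zmod_two_cases (y j) with hy | hy <;> simp [ha, hx, hy] <;> grind

theorem traceInner_smul_omega_sq (hω : ω ^ 2 = ω + 1) {ι : Type} [Fintype ι]
    (a x y : ι → ZMod 2) :
    traceInner (fun j => a j • ω ^ 2) (fun j => x j • ω + y j • ω ^ 2) =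
      algebraMap (ZMod 2) K (∑ j, a j * x j) := by
  have h2 : (2 : K) = 0 := by
    have := add_self_of_algebra (1 : K)
    rwa [one_add_one_eq_two] at this
  rw [traceInner, map_sum]
  refine Finset.sum_congr rfl fun j _ => ?_
  rcases zmod_two_cases (a j) with ha | ha <;> rcases zmod_two_cases (x j) with hx | hx <;>
    rcases zmod_two_cases (y j) with hy | hy <;> simp [ha, hx, hy] <;> grind

theorem eq_zero_of_traceInner_eq_zero (hω : ω ^ 2 = ω + 1) {ι : Type} [Fintype ι]
    (u : ι → K) (h : ∀ v, traceInner u v = 0) : u = 0 := by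
  classical
  funext i
  -- This test vector yields u³(ω² + ω) = u³ with u = u i.
  have h1 := h (Pi.single i (ω * u i))
  rw [traceInner, Finset.sum_eq_single i] at h1
  · rw [Pi.single_eq_same] at h1
    have h3 : u i ^ 3 = 0 := by
      linear_combination h1 - (u i ^ 3) * hω - add_self_of_algebra (ω * u i ^ 3)
    exact eq_zero_of_pow_eq_zero h3
  · intro j _ hj
    rw [Pi.single_eq_of_ne hj]; ring
  · exact fun h => absurd (Finset.mem_univ i) h

theorem traceInner_smul_left {ι : Type} [Fintype ι] (a : ZMod 2) (u v : ι → K) :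
    traceInner (a • u) v = a • traceInner u v := by
  rcases zmod_two_cases a with rfl | rfl <;> simp

/-- Turns the trace form, whose values are 0 and 1 inside K, into a bilinear form over `ZMod 2`
without losing information. -/
theorem exists_functional : ∃ f : K →ₗ[ZMod 2] ZMod 2, f 1 = 1 := by
  obtain ⟨f, hf⟩ := LinearMap.exists_leftInverse_of_injective (Algebra.linearMap (ZMod 2) K)
    (LinearMap.ker_eq_bot.2 (algebraMap (ZMod 2) K).injective)
  refine ⟨f, ?_⟩
  have := LinearMap.congr_fun hf 1
  simpa using this

/-- The dimension of the trace-dual of an additive code. -/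
theorem exists_dual_submodule (hK : Nat.card K = 4) (hω : ω ^ 2 = ω + 1) (l : ℕ)
    (W : Submodule (ZMod 2) (Fin l → K)) :
    ∃ D : Submodule (ZMod 2) (Fin l → K), (D : Set (Fin l → K)) = traceDual (W : Set (Fin l → K)) ∧
      Module.finrank (ZMod 2) D + Module.finrank (ZMod 2) W = 2 * l := by
  obtain ⟨f, hf⟩ := exists_functional (K := K)
  have : Finite K := Nat.finite_of_card_ne_zero (by omega)
  have hfin : Module.Finite (ZMod 2) K := Module.Finite.of_finite
  let B : LinearMap.BilinForm (ZMod 2) (Fin l → K) :=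
    LinearMap.mk₂ (ZMod 2) (fun u v => f (traceInner u v))
      (fun u v w => by rw [traceInner_add_left, map_add])
      (fun a u v => by rw [traceInner_smul_left, map_smul])
      (fun u v w => by rw [traceInner_add_right, map_add])
      (fun a u v => by rw [traceInner_comm, traceInner_smul_left, map_smul, traceInner_comm])
  have hB : ∀ u v, B u v = 0 ↔ traceInner u v = 0 := by
    intro u v
    change f (traceInner u v) = 0 ↔ _
    rcases traceInner_eq_zero_or_one hK hω u v with h | h <;> rw [h] <;> simp [hf]
  have hnd : B.Nondegenerate := by
    constructor
    · intro u hu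
      exact eq_zero_of_traceInner_eq_zero hω u fun v => (hB u v).1 (hu v)
    · intro u hu
      refine eq_zero_of_traceInner_eq_zero hω u fun v => ?_
      rw [traceInner_comm]
      exact (hB v u).1 (hu v)
  refine ⟨B.orthogonal W, ?_, ?_⟩
  · ext u
    simp only [SetLike.mem_coe, LinearMap.BilinForm.mem_orthogonal_iff, traceDual,
      Set.mem_ofPred_eq]
    refine forall₂_congr fun v _ => ?_
    rw [traceInner_comm]
    exact hB v u
  · have hk2 : Module.finrank (ZMod 2) K = 2 := by
      have h := Module.natCard_eq_pow_finrank (K := ZMod 2) (V := K)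
      rw [hK, Nat.card_zmod] at h
      exact (Nat.pow_right_injective le_rfl (show 2 ^ 2 = 2 ^ _ from h)).symm
    have h1 := LinearMap.BilinForm.finrank_orthogonal hnd W
    have h2 := Submodule.finrank_le W
    rw [Module.finrank_pi_fintype, Finset.sum_const, hk2, Finset.card_univ, Fintype.card_fin,
      smul_eq_mul] at h1 h2
    omega

end TraceDual

/-! ## Reed–Solomon codes -/

section ReedSolomon

variable {F : Type} [Field F]

theorem pow_injective_of_orderOf {α : F} {n : ℕ} (hα : orderOf α = n) :
    Function.Injective fun i : Fin n => α ^ (i : ℕ) := fun i j hij =>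
  Fin.ext (pow_injOn_Iio_orderOf (by simp [hα]) (by simp [hα]) hij)

theorem ne_zero_of_orderOf {α : F} {n : ℕ} (hα : orderOf α = n) (hn : 0 < n) : α ≠ 0 := by
  rintro rfl
  have := pow_orderOf_eq_one (0 : F)
  rw [hα, zero_pow hn.ne'] at this
  exact zero_ne_one this

/-- The vectors `(β * α ^ (i * (l + 1)))_i`, `l < k`, belong to the Reed–Solomon code. -/
theorem mul_pow_mem_rsCode {α : F} {n k : ℕ} (hα : orderOf α = n) (β : F) {l : ℕ}
    (hl : l < k) (hk : k ≤ n) :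
    (fun i : Fin n => β * α ^ ((i : ℕ) * (l + 1))) ∈ rsCode α n k := by
  refine Finset.prod_dvd_of_coprime ?_ ?_
  · intro i hi j hj hij
    refine Polynomial.isCoprime_X_sub_C_of_isUnit_sub ?_
    refine IsUnit.mk0 _ (sub_ne_zero.2 fun h => hij ?_)
    have hi' := Finset.mem_range.1 hi
    have hj' := Finset.mem_range.1 hj
    exact pow_injOn_Iio_orderOf (by simp [hα]; omega) (by simp [hα]; omega) h
  · intro i hi
    have hi' := Finset.mem_range.1 hi
    rw [Polynomial.dvd_iff_isRoot, Polynomial.IsRoot, Polynomial.eval_finsetSum]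
    -- From l < k and i < n - k the exponent lies between 1 and n - 1; hence the geometric sum over
    -- the n-th roots of unity vanishes.
    have h1 : α ^ (l + 1 + i) ≠ 1 := by
      rw [Ne, ← orderOf_dvd_iff_pow_eq_one, hα]
      exact Nat.not_dvd_of_pos_of_lt (by omega) (by omega)
    have h2 : ∑ t ∈ Finset.range n, (α ^ (l + 1 + i)) ^ t = 0 := by
      rw [geom_sum_eq h1, ← pow_mul, mul_comm, pow_mul, ← hα, pow_orderOf_eq_one]
      simp
    rw [Finset.sum_congr rfl (g := fun t : Fin n => β * (α ^ (l + 1 + i)) ^ (t : ℕ)),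
      ← Finset.mul_sum, Fin.sum_univ_eq_sum_range fun t => (α ^ (l + 1 + i)) ^ t, h2, mul_zero]
    intro t _
    simp only [Polynomial.eval_mul, Polynomial.eval_C, Polynomial.eval_pow, Polynomial.eval_X]
    rw [← pow_mul, ← pow_mul, mul_assoc, ← pow_add]
    congr 2
    ring

/-- The BCH bound: a support of at most k positions would give a square Vandermonde system with only
the zero solution. -/
theorem lt_card_support_of_sum_eq_zero [DecidableEq F] {α : F} {n k : ℕ} (hα : orderOf α = n)
    (hn : 0 < n) {Y : Fin n → F} (hY : Y ≠ 0)
    (h : ∀ l < k, ∑ i, Y i * α ^ ((i : ℕ) * (l + 1)) = 0) :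
    k < (Finset.univ.filter fun i => Y i ≠ 0).card := by
  by_contra! hle
  refine hY (funext fun i => ?_)
  by_contra hi
  have := eq_zero_of_sum_mul_pow_eq_zero (Finset.univ.filter fun i => Y i ≠ 0)
    (fun i : Fin n => α ^ (i : ℕ)) Y (pow_injective_of_orderOf hα).injOn 1
    (fun p _ => pow_ne_zero _ (ne_zero_of_orderOf hα hn)) (by
      intro j hj
      refine Eq.trans ?_ (h j (by omega))
      rw [Finset.sum_filter]
      refine Finset.sum_congr rfl fun i _ => ?_
      split_ifs with h0
      · rw [← pow_mul, add_comm 1 j]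
      · rw [not_not.1 h0, zero_mul])
  exact hi (this i (by simpa using hi))

variable [Algebra (ZMod 2) F] {m : ℕ} (b : Module.Basis (Fin m) (ZMod 2) F)

/-- Self-duality says that coordinates are traces against the basis itself. -/
theorem trace_basis_mul (hb : ∀ i j, Algebra.trace (ZMod 2) F (b i * b j) = if i = j then 1 else 0)
    (i : Fin m) (v : F) : Algebra.trace (ZMod 2) F (b i * v) = b.repr v i := by
  conv_lhs => rw [← b.sum_repr v]
  simp only [Finset.mul_sum, map_sum, mul_smul_comm, map_smul, hb, smul_eq_mul, mul_ite, mul_one,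
    mul_zero, Finset.sum_ite_eq, Finset.mem_univ, if_true]

theorem trace_mul (hb : ∀ i j, Algebra.trace (ZMod 2) F (b i * b j) = if i = j then 1 else 0)
    (u v : F) : Algebra.trace (ZMod 2) F (u * v) = ∑ j, b.repr u j * b.repr v j := by
  conv_lhs => rw [← b.sum_repr u]
  simp only [Finset.sum_mul, map_sum, smul_mul_assoc, map_smul, trace_basis_mul b hb, smul_eq_mul]

end ReedSolomon

/-! ## The quantum Zyablov code -/

namespace ZyablovCode

variable {K F : Type} [Field K] [DecidableEq K] [Algebra (ZMod 2) K]
  [Field F] [Algebra (ZMod 2) F] {m n k n₂ s : ℕ}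

theorem two_le_m (Z : ZyablovCode K F m n k n₂ s) : 2 ≤ m := by
  have h1 := Z.k_pos
  have h2 := Z.k_le
  by_contra! h
  interval_cases m <;> simp at h2 <;> omega

theorem two_mul_k_lt_n (Z : ZyablovCode K F m n k n₂ s) : 2 * k < n := by
  have h1 := Z.k_le
  have h2 := Z.length_eq
  have h3 := Z.two_le_m
  have h4 : 2 ^ m = 2 * 2 ^ (m - 1) := by
    rw [← pow_succ', Nat.sub_add_cancel (by omega)]
  have h5 := Z.k_pos
  omega

theorem n_pos (Z : ZyablovCode K F m n k n₂ s) : 0 < n := by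
  have := Z.two_mul_k_lt_n; omega

variable (Z : ZyablovCode K F m n k n₂ s)

/-- The restriction of a vector to an inner block. -/
def block (c : Fin n × Fin n₂ → K) (i : Fin n) : Fin n₂ → K := fun q => c (i, q)

omit [DecidableEq K] [Algebra (ZMod 2) K] in
theorem traceInner_eq_sum_block (c d : Fin n × Fin n₂ → K) :
    traceInner c d = ∑ i, traceInner (block c i) (block d i) := by
  simp only [traceInner, Fintype.sum_prod_type, block]

omit [Algebra (ZMod 2) K] in
theorem hammingNorm_eq_sum_block (c : Fin n × Fin n₂ → K) :
    hammingNorm c = ∑ i, hammingNorm (block c i) := by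
  rw [hammingNorm, Finset.card_filter, Fintype.sum_prod_type]
  refine Finset.sum_congr rfl fun i _ => ?_
  rw [hammingNorm, Finset.card_filter]
  rfl

theorem block_blockVec (i j : Fin n) (u : Fin n₂ → K) :
    block (Z.blockVec i u) j = if j = i then u else 0 := by
  funext q
  simp only [block, blockVec]
  split_ifs <;> rfl

theorem block_outerGen (x : K) (l : Fin k) (j : Fin m) (i : Fin n) : block (Z.outerGen x l j) i =
    Z.ρ fun j' => Z.b.repr (Z.b j * Z.α ^ ((i : ℕ) * ((l : ℕ) + 1))) j' • x := rfl

theorem traceInner_blockVec (i : Fin n) (u : Fin n₂ → K) (c : Fin n × Fin n₂ → K) :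
    traceInner (Z.blockVec i u) c = traceInner u (block c i) := by
  rw [traceInner_eq_sum_block, Finset.sum_eq_single i]
  · rw [block_blockVec, if_pos rfl]
  · intro j _ hj
    rw [block_blockVec, if_neg hj, traceInner_zero_left]
  · exact fun h => absurd (Finset.mem_univ i) h

theorem zero_mem_binaryExpansion : (0 : Fin n → Fin m → ZMod 2) ∈
    binaryExpansion Z.b (rsCode Z.α n k) := by
  simp [binaryExpansion, rsCode]

theorem zero_mem_C₁ : (0 : Fin n → Fin m → K) ∈ Z.C₁ :=
  ⟨0, Z.zero_mem_binaryExpansion, 0, Z.zero_mem_binaryExpansion, by simp⟩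

theorem mem_stabilizer_of_block_mem {c : Fin n × Fin n₂ → K} (h : ∀ i, block c i ∈ Z.C₂) :
    c ∈ Z.stabilizer :=
  ⟨0, Z.zero_mem_C₁, block c, h, fun p => by simp [block]⟩

theorem gen_mem (j : Fin s) : Z.gen j ∈ Z.C₂ := AddSubgroup.subset_closure ⟨j, rfl⟩

theorem blockVec_mem {u : Fin n₂ → K} (hu : u ∈ Z.C₂) (i : Fin n) :
    Z.blockVec i u ∈ Z.stabilizer := by
  refine Z.mem_stabilizer_of_block_mem fun j => ?_
  rw [block_blockVec]
  split_ifs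
  · exact hu
  · exact Z.C₂.zero_mem

theorem repr_mem_binaryExpansion (β : F) (l : Fin k) :
    (fun (i : Fin n) (j : Fin m) => Z.b.repr (β * Z.α ^ ((i : ℕ) * ((l : ℕ) + 1))) j) ∈
      binaryExpansion Z.b (rsCode Z.α n k) := by
  simp only [binaryExpansion, Set.mem_ofPred_eq, Module.Basis.sum_repr]
  refine mul_pow_mem_rsCode Z.α_primitive β l.2 ?_
  have := Z.two_mul_k_lt_n
  omega

theorem outerGen_omega_mem (l : Fin k) (j : Fin m) : Z.outerGen Z.ω l j ∈ Z.stabilizer :=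
  ⟨_, ⟨_, Z.repr_mem_binaryExpansion (Z.b j) l, 0, Z.zero_mem_binaryExpansion, fun _ _ => rfl⟩, 0,
    fun _ => Z.C₂.zero_mem, fun p => by simp [outerGen]⟩

theorem outerGen_omega_sq_mem (l : Fin k) (j : Fin m) :
    Z.outerGen (Z.ω ^ 2) l j ∈ Z.stabilizer :=
  ⟨_, ⟨0, Z.zero_mem_binaryExpansion, _, Z.repr_mem_binaryExpansion (Z.b j) l, fun _ _ => rfl⟩, 0,
    fun _ => Z.C₂.zero_mem, fun p => by simp [outerGen]⟩

/-- If ρ(v) lies in C₂, it is orthogonal to the whole image of ρ, so v is orthogonal to everything,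
and the form on 𝔽₄^m is nondegenerate. -/
theorem rho_mem_iff (v : Fin m → K) : Z.ρ v ∈ Z.C₂ ↔ v = 0 := by
  refine ⟨fun h => eq_zero_of_traceInner_eq_zero Z.ω_sq v fun u => ?_, ?_⟩
  · rw [← Z.ρ_inner, traceInner_comm]
    exact Z.ρ_mem u _ h
  · rintro rfl
    rw [map_zero]
    exact Z.C₂.zero_mem

/-- The dual of the inner code is spanned by the inner code and the image of `ρ`. -/
theorem exists_rho_add {c : Fin n₂ → K} (hc : c ∈ traceDual (Z.C₂ : Set (Fin n₂ → K))) :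
    ∃ w, ∃ u ∈ Z.C₂, c = Z.ρ w + u := by
  set W : Submodule (ZMod 2) (Fin n₂ → K) := AddSubgroup.toZModSubmodule 2 Z.C₂ with hW
  obtain ⟨D, hD, hdim⟩ := exists_dual_submodule Z.card_K Z.ω_sq n₂ W
  have : Finite K := Nat.finite_of_card_ne_zero (by rw [Z.card_K]; omega)
  have hfin : Module.Finite (ZMod 2) K := Module.Finite.of_finite
  have hcardW : Module.finrank (ZMod 2) W = s := by
    have h := Module.natCard_eq_pow_finrank (K := ZMod 2) (V := W)
    rw [Nat.card_zmod] at h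
    have h' : Nat.card W = 2 ^ s := Z.card_inner
    rw [h'] at h
    exact (Nat.pow_right_injective le_rfl h).symm
  let R : (Fin m → K) →ₗ[ZMod 2] (Fin n₂ → K) := Z.ρ.toZModLinearMap 2
  have hRinj : LinearMap.ker R = ⊥ := by
    rw [LinearMap.ker_eq_bot']
    intro v hv
    refine (Z.rho_mem_iff v).1 ?_
    rw [show Z.ρ v = 0 from hv]
    exact Z.C₂.zero_mem
  have hk2 : Module.finrank (ZMod 2) K = 2 := by
    have h := Module.natCard_eq_pow_finrank (K := ZMod 2) (V := K)
    rw [Z.card_K, Nat.card_zmod] at h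
    exact (Nat.pow_right_injective le_rfl (show 2 ^ 2 = 2 ^ _ from h)).symm
  have hcardR : Module.finrank (ZMod 2) (LinearMap.range R) = 2 * m := by
    rw [LinearMap.finrank_range_of_inj (LinearMap.ker_eq_bot.1 hRinj), Module.finrank_pi_fintype,
      Finset.sum_const, hk2, Finset.card_univ, Fintype.card_fin, smul_eq_mul, mul_comm]
  have hinf : LinearMap.range R ⊓ W = ⊥ := by
    rw [eq_bot_iff]
    rintro _ ⟨⟨v, rfl⟩, hv⟩
    rw [(Z.rho_mem_iff v).1 hv]
    simp
  have hle : LinearMap.range R ⊔ W ≤ D := by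
    rw [sup_le_iff]
    constructor
    · rintro _ ⟨v, rfl⟩
      rw [← SetLike.mem_coe, hD]
      exact Z.ρ_mem v
    · intro u hu
      rw [← SetLike.mem_coe, hD]
      exact Z.self_orthogonal hu
  have hsup := Submodule.finrank_sup_add_finrank_inf_eq (LinearMap.range R) W
  rw [hinf, finrank_bot, add_zero, hcardR, hcardW] at hsup
  have heq : LinearMap.range R ⊔ W = D := by
    -- Dimension count: 2m + s = 2n₂ - s, because s + m = n₂.
    refine Submodule.eq_of_le_of_finrank_eq hle ?_
    have := Z.inner_length_eq
    omega
  have hcD : c ∈ LinearMap.range R ⊔ W := by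
    rw [heq, ← SetLike.mem_coe, hD]
    exact hc
  obtain ⟨_, ⟨w, rfl⟩, u, hu, rfl⟩ := Submodule.mem_sup.1 hcD
  exact ⟨w, u, hu, rfl⟩

/-- The dual of the inner code modulo the inner code, in coordinates. -/
theorem exists_coordinates {c : Fin n × Fin n₂ → K}
    (hc : ∀ i, block c i ∈ traceDual (Z.C₂ : Set (Fin n₂ → K))) :
    ∃ x y : Fin n → Fin m → ZMod 2, ∀ i, ∃ u ∈ Z.C₂,
      block c i = Z.ρ (fun j => x i j • Z.ω + y i j • Z.ω ^ 2) + u := by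
  have : ∀ i, ∃ x y : Fin m → ZMod 2, ∃ u ∈ Z.C₂,
      block c i = Z.ρ (fun j => x j • Z.ω + y j • Z.ω ^ 2) + u := by
    intro i
    obtain ⟨w, u, hu, h⟩ := Z.exists_rho_add (hc i)
    obtain ⟨x, y, rfl⟩ := exists_smul_omega_add Z.card_K Z.ω_sq w
    exact ⟨x, y, u, hu, h⟩
  choose x y h using this
  exact ⟨x, y, h⟩

/-- The elements of `F` with given coordinates. -/
noncomputable def symbols (x : Fin n → Fin m → ZMod 2) (i : Fin n) : F :=
  ∑ j, x i j • Z.b j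

theorem repr_symbols (x : Fin n → Fin m → ZMod 2) (i : Fin n) (j : Fin m) :
    Z.b.repr (Z.symbols x i) j = x i j := by
  rw [symbols, Module.Basis.repr_sum_self]

/-- Both sides are the trace of b_j times the power sum of the symbols, so measuring with j = 0, …,
m - 1 reads off one syndrome in F. -/
theorem sum_repr_mul (x : Fin n → Fin m → ZMod 2) (l : Fin k) (j : Fin m) :
    ∑ i : Fin n, ∑ j', Z.b.repr (Z.b j * Z.α ^ ((i : ℕ) * ((l : ℕ) + 1))) j' * x i j' =
      Z.b.repr (∑ i, Z.symbols x i * Z.α ^ ((i : ℕ) * ((l : ℕ) + 1))) j := by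
  rw [← trace_basis_mul Z.b Z.self_dual, Finset.mul_sum, map_sum]
  refine Finset.sum_congr rfl fun i _ => ?_
  rw [show Z.b j * (Z.symbols x i * Z.α ^ ((i : ℕ) * ((l : ℕ) + 1))) =
    (Z.b j * Z.α ^ ((i : ℕ) * ((l : ℕ) + 1))) * Z.symbols x i by ring, trace_mul Z.b Z.self_dual]
  exact Finset.sum_congr rfl fun j' _ => by rw [repr_symbols]

variable {Z} {c : Fin n × Fin n₂ → K} {x y : Fin n → Fin m → ZMod 2}

/-- The C₂-component is invisible because ρ takes values in C₂^⊥; on the rest ρ preserves the form.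
-/
theorem traceInner_rho_block
    (h : ∀ i, ∃ u ∈ Z.C₂, block c i = Z.ρ (fun j => x i j • Z.ω + y i j • Z.ω ^ 2) + u)
    (v : Fin m → K) (i : Fin n) : traceInner (Z.ρ v) (block c i) =
      traceInner v (fun j => x i j • Z.ω + y i j • Z.ω ^ 2) := by
  obtain ⟨u, hu, hc⟩ := h i
  rw [hc, traceInner_add_right, Z.ρ_inner, Z.ρ_mem v u hu, add_zero]

theorem traceInner_outerGen_omega
    (h : ∀ i, ∃ u ∈ Z.C₂, block c i = Z.ρ (fun j => x i j • Z.ω + y i j • Z.ω ^ 2) + u)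
    (l : Fin k) (j : Fin m) : traceInner (Z.outerGen Z.ω l j) c = algebraMap (ZMod 2) K
      (Z.b.repr (∑ i, Z.symbols y i * Z.α ^ ((i : ℕ) * ((l : ℕ) + 1))) j) := by
  rw [traceInner_eq_sum_block, ← sum_repr_mul, map_sum]
  refine Finset.sum_congr rfl fun i _ => ?_
  rw [block_outerGen, traceInner_rho_block h, traceInner_smul_omega Z.ω_sq]

theorem traceInner_outerGen_omega_sq
    (h : ∀ i, ∃ u ∈ Z.C₂, block c i = Z.ρ (fun j => x i j • Z.ω + y i j • Z.ω ^ 2) + u)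
    (l : Fin k) (j : Fin m) : traceInner (Z.outerGen (Z.ω ^ 2) l j) c = algebraMap (ZMod 2) K
      (Z.b.repr (∑ i, Z.symbols x i * Z.α ^ ((i : ℕ) * ((l : ℕ) + 1))) j) := by
  rw [traceInner_eq_sum_block, ← sum_repr_mul, map_sum]
  refine Finset.sum_congr rfl fun i _ => ?_
  rw [block_outerGen, traceInner_rho_block h, traceInner_smul_omega_sq Z.ω_sq]

variable (Z)

theorem δ_mul_numQubits : Z.δ * Z.numQubits = k * (Z.δ₂ * n₂) := by
  have h : (n : ℝ) ≠ 0 := Nat.cast_ne_zero.2 Z.n_pos.ne'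
  rw [δ, numQubits]
  push_cast
  field_simp

variable {Z}

omit [Algebra (ZMod 2) K] in
theorem mul_card_le_hammingNorm {A : Finset (Fin n)} {t : ℝ}
    (h : ∀ i ∈ A, t ≤ hammingNorm (block c i)) : A.card * t ≤ hammingNorm c := by
  rw [hammingNorm_eq_sum_block]
  push_cast
  calc (A.card : ℝ) * t = ∑ i ∈ A, t := by simp
    _ ≤ ∑ i ∈ A, (hammingNorm (block c i) : ℝ) := Finset.sum_le_sum h
    _ ≤ _ := Finset.sum_le_univ_sum_of_nonneg fun i => by positivity

/-- Turns counts of nonzero symbols into counts of blocks outside C₂: a block in C₂ has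
ρ-coordinates zero. -/
theorem symbols_support_subset
    (h : ∀ i, ∃ u ∈ Z.C₂, block c i = Z.ρ (fun j => x i j • Z.ω + y i j • Z.ω ^ 2) + u) {i : Fin n}
    (hi : Z.symbols x i ≠ 0 ∨ Z.symbols y i ≠ 0) : block c i ∉ Z.C₂ := by
  intro hmem
  obtain ⟨u, hu, hc⟩ := h i
  rw [hc, Z.C₂.add_mem_cancel_right hu, rho_mem_iff] at hmem
  have hx := fun v : Fin m → ZMod 2 => traceInner_smul_omega_sq Z.ω_sq v (x i) (y i)
  have hy := fun v : Fin m → ZMod 2 => traceInner_smul_omega Z.ω_sq v (x i) (y i)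
  simp only [hmem, traceInner_zero_right, eq_comm (a := (0 : K)), map_eq_zero] at hx hy
  have hx0 : x i = 0 := funext fun j => by simpa [Pi.single_apply] using hx (Pi.single j 1)
  have hy0 : y i = 0 := funext fun j => by simpa [Pi.single_apply] using hy (Pi.single j 1)
  rcases hi with hi | hi
  · exact hi (by simp [symbols, hx0])
  · exact hi (by simp [symbols, hy0])

variable (Z) [DecidableEq F]

/-- The relative minimum distance of the quantum Zyablov code is at least `δ`. -/
theorem distance_le {c : Fin n × Fin n₂ → K} (hc : c ∈ traceDual Z.stabilizer)
    (hcS : c ∉ Z.stabilizer) : Z.δ * Z.numQubits ≤ hammingNorm c := by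
  have hblock : ∀ i, block c i ∈ traceDual (Z.C₂ : Set (Fin n₂ → K)) := by
    intro i u hu
    rw [traceInner_comm, ← Z.traceInner_blockVec, traceInner_comm]
    exact hc _ (Z.blockVec_mem hu i)
  obtain ⟨x, y, h⟩ := Z.exists_coordinates hblock
  have hx : ∀ l < k, ∑ i, Z.symbols x i * Z.α ^ ((i : ℕ) * (l + 1)) = 0 := by
    intro l hl
    refine Z.b.repr.injective (Finsupp.ext fun j => ?_)
    have h1 := traceInner_outerGen_omega_sq h ⟨l, hl⟩ j
    rw [traceInner_comm, hc _ (Z.outerGen_omega_sq_mem _ _)] at h1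
    simpa using ((map_eq_zero _).1 h1.symm)
  have hy : ∀ l < k, ∑ i, Z.symbols y i * Z.α ^ ((i : ℕ) * (l + 1)) = 0 := by
    intro l hl
    refine Z.b.repr.injective (Finsupp.ext fun j => ?_)
    have h1 := traceInner_outerGen_omega h ⟨l, hl⟩ j
    rw [traceInner_comm, hc _ (Z.outerGen_omega_mem _ _)] at h1
    simpa using ((map_eq_zero _).1 h1.symm)
  -- If both words were zero, every block would lie in C₂ and c in the stabilizer; a nonzero word
  -- has more than k nonzero symbols.
  have key : ∃ A : Finset (Fin n), k ≤ A.card ∧ ∀ i ∈ A, block c i ∉ Z.C₂ := by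
    by_cases hx0 : Z.symbols x = 0
    · have hy0 : Z.symbols y ≠ 0 := by
        intro hy0
        refine hcS (Z.mem_stabilizer_of_block_mem fun i => ?_)
        obtain ⟨u, hu, hb⟩ := h i
        have hx1 : ∀ j, x i j = 0 := fun j => by rw [← Z.repr_symbols x, hx0]; simp
        have hy1 : ∀ j, y i j = 0 := fun j => by rw [← Z.repr_symbols y, hy0]; simp
        rw [hb, show (fun j => x i j • Z.ω + y i j • Z.ω ^ 2) = 0 from
          funext fun j => by simp [hx1, hy1], map_zero, zero_add]
        exact hu
      exact ⟨_, (lt_card_support_of_sum_eq_zero Z.α_primitive Z.n_pos hy0 hy).le, fun i hi =>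
        symbols_support_subset h (Or.inr (Finset.mem_filter.1 hi).2)⟩
    · exact ⟨_, (lt_card_support_of_sum_eq_zero Z.α_primitive Z.n_pos hx0 hx).le, fun i hi =>
        symbols_support_subset h (Or.inl (Finset.mem_filter.1 hi).2)⟩
  obtain ⟨A, hA, hAc⟩ := key
  have h1 := mul_card_le_hammingNorm fun i hi => Z.inner_dist _ (hblock i) (hAc i hi)
  rw [δ_mul_numQubits]
  -- The sign of δ₂ is not prescribed; for a negative value the bound is trivial.
  rcases le_or_gt 0 (Z.δ₂ * n₂) with h0 | h0
  · exact le_trans (mul_le_mul_of_nonneg_right (Nat.cast_le.2 hA) h0) h1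
  · exact (mul_nonpos_of_nonneg_of_nonpos (by positivity) h0.le).trans (by positivity)

end ZyablovCode

end QZ
namespace QZ

/-! ## Symbolic runs of composed programs -/

namespace QProg

variable {K ι α β : Type} [Field K] [DecidableEq K] [Fintype ι] [DecidableEq ι]
  {χ : (ι → K) → Bool} {S : Set (ι → K)}

theorem sim_bind (p : QProg K ι α) (f : α → QProg K ι β) (e : ι → K) :
    sim χ (p >>= f) e = sim χ (f (sim χ p e).1) (sim χ p e).2 := by
  change sim χ (seq f p) e = _
  induction p generalizing e with
  | ret a => rfl
  | work c p ih => exact ih e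
  | gate q x p ih => exact ih _
  | measure g next ih => exact ih _ e

theorem sim_pure (a : α) (e : ι → K) : sim χ (pure a : QProg K ι α) e = (a, e) := rfl

theorem sim_classical (t : Timed α) (e : ι → K) :
    sim χ (classical t : QProg K ι α) e = (t.val, e) := rfl

/-- The sign of the code enters twice and cancels, leaving only the commutation bit of the error. -/
theorem sim_syndromeBit (g e : ι → K) :
    sim χ (syndromeBit χ g) e = (decide (traceInner g e ≠ 0), e) := by
  simp only [syndromeBit, sim, Prod.mk.injEq, and_true]
  rw [Bool.xor_comm (χ g), Bool.xor_assoc, Bool.xor_self, Bool.xor_false]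

/-- Quantifying over sets T that omit i expresses independence: the i-th program must give the same
result and add the same vector whatever the others have already added. -/
theorem sim_collect {len : ℕ} (p : Fin len → QProg K ι α) (e : ι → K) (a : Fin len → α)
    (c : Fin len → ι → K) (h : ∀ i (T : Finset (Fin len)), i ∉ T →
      sim χ (p i) (e + ∑ j ∈ T, c j) = (a i, e + ∑ j ∈ T, c j + c i)) :
    sim χ (collect p) e = (a, e + ∑ j, c j) := by
  induction len generalizing e with
  | zero =>
    simp only [collect, sim, Finset.univ_eq_empty, Finset.sum_empty, add_zero]
    exact Prod.ext (Subsingleton.elim _ _) rfl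
  | succ l ih =>
    have h0 := h 0 ∅ (Finset.notMem_empty _)
    rw [Finset.sum_empty, add_zero] at h0
    have h1 := ih (fun i => p i.succ) (e + c 0) (fun i => a i.succ) (fun i => c i.succ) (by
      intro i T hi
      have h2 := h i.succ (insert 0 (T.map (Fin.succEmb l))) (by simpa using hi)
      rwa [Finset.sum_insert (by simp), Finset.sum_map, ← add_assoc] at h2)
    rw [collect, sim_bind, h0, sim_bind, h1]
    simp only [sim, Fin.sum_univ_succ, ← add_assoc, Prod.mk.injEq, and_true]
    exact Fin.cons_self_tail a

theorem sim_collect_of_eq {len : ℕ} (p : Fin len → QProg K ι α) (e : ι → K) (a : Fin len → α)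
    (h : ∀ i, sim χ (p i) e = (a i, e)) : sim χ (collect p) e = (a, e) := by
  have := sim_collect p e a 0 (χ := χ) (by simpa using fun i _ _ => h i)
  simpa using this

end QProg

/-! ### Composition of programs that measure only stabilizer elements -/

namespace QProg

variable {K ι α β : Type} {χ : (ι → K) → Bool} {S : Set (ι → K)}

theorem MeasuresIn.bind {p : QProg K ι α} {f : α → QProg K ι β} (hp : MeasuresIn S p)
    (hf : ∀ a, MeasuresIn S (f a)) : MeasuresIn S (p >>= f) := by
  change MeasuresIn S (seq f p)
  induction p with
  | ret a => exact hf a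
  | work c p ih => exact ih hp
  | gate q x p ih => exact ih hp
  | measure g next ih => exact ⟨hp.1, fun o => ih o (hp.2 o)⟩

theorem measuresIn_pure (a : α) : MeasuresIn S (pure a : QProg K ι α) := trivial

theorem measuresIn_classical (t : Timed α) : MeasuresIn S (classical t : QProg K ι α) := trivial

theorem measuresIn_syndromeBit {g : ι → K} (hg : g ∈ S) : MeasuresIn S (syndromeBit χ g) :=
  ⟨hg, fun _ => trivial⟩

theorem MeasuresIn.collect {len : ℕ} {p : Fin len → QProg K ι α} (hp : ∀ i, MeasuresIn S (p i)) :
    MeasuresIn S (collect p) := by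
  induction len with
  | zero => trivial
  | succ l ih => exact (hp 0).bind fun a => (ih fun i => hp i.succ).bind fun as => trivial

end QProg

/-! ## Correctness of the decoder -/

namespace ZyablovCode

open QProg

variable {K F : Type} [Field K] [DecidableEq K] [Algebra (ZMod 2) K]
  [Field F] [Algebra (ZMod 2) F] {m n k n₂ s : ℕ}
  (Z : ZyablovCode K F m n k n₂ s) {χ : (Fin n × Fin n₂ → K) → Bool}
  {S : Set (Fin n × Fin n₂ → K)}

theorem measuresIn_applyBlock (i : Fin n) (u : Fin n₂ → K) :
    MeasuresIn S (Z.applyBlock i u) := by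
  unfold applyBlock
  refine MeasuresIn.bind (MeasuresIn.collect fun _ => ?_) fun _ => ?_ <;> trivial

theorem measuresIn_innerStage (est : (Fin s → Bool) → Timed (Fin n₂ → K)) :
    MeasuresIn Z.stabilizer (Z.innerStage est χ) :=
  (MeasuresIn.collect fun i => (MeasuresIn.collect fun j => measuresIn_syndromeBit
    (Z.blockVec_mem (Z.gen_mem j) i)).bind fun _ => (measuresIn_classical _).bind fun e =>
      Z.measuresIn_applyBlock i e).bind fun _ => measuresIn_pure _

theorem measuresIn_outerSyndrome {x : K} (hx : ∀ l j, Z.outerGen x l j ∈ Z.stabilizer) :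
    MeasuresIn Z.stabilizer (Z.outerSyndrome x χ) :=
  (MeasuresIn.collect fun l => (MeasuresIn.collect fun j => measuresIn_syndromeBit
    (hx l j)).bind fun _ => measuresIn_classical _).bind fun _ => measuresIn_pure _

theorem measuresIn_outerStage [DecidableEq F] : MeasuresIn Z.stabilizer (Z.outerStage χ) :=
  (Z.measuresIn_outerSyndrome Z.outerGen_omega_mem).bind fun _ =>
    (Z.measuresIn_outerSyndrome Z.outerGen_omega_sq_mem).bind fun _ =>
      (measuresIn_classical _).bind fun _ => (measuresIn_classical _).bind fun _ =>
        (MeasuresIn.collect fun i => (measuresIn_classical _).bind fun _ =>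
          (measuresIn_classical _).bind fun _ => (measuresIn_classical _).bind fun e =>
            Z.measuresIn_applyBlock i e).bind fun _ => measuresIn_pure _

theorem measuresIn_decoder [DecidableEq F] (est : (Fin s → Bool) → Timed (Fin n₂ → K)) :
    MeasuresIn Z.stabilizer (Z.decoder est χ) :=
  (Z.measuresIn_innerStage est).bind fun _ => Z.measuresIn_outerStage

theorem sum_single_eq_blockVec (i : Fin n) (u : Fin n₂ → K) :
    ∑ q, (Pi.single (i, q) (u q) : Fin n × Fin n₂ → K) = Z.blockVec i u := by
  funext ⟨i', q'⟩
  rw [Finset.sum_apply]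
  simp only [Pi.single_apply, Prod.mk.injEq, blockVec]
  by_cases h : i' = i
  · simp [h]
  · simp [h]

theorem sim_applyBlock (i : Fin n) (u : Fin n₂ → K) (e : Fin n × Fin n₂ → K) :
    sim χ (Z.applyBlock i u) e = ((), e + Z.blockVec i u) := by
  rw [applyBlock, sim_bind, sim_collect _ e (fun _ => ()) fun q => Pi.single (i, q) (u q)]
  · rw [Z.sum_single_eq_blockVec]; rfl
  · intro q T _
    rfl

theorem block_add_sum_blockVec (e : Fin n × Fin n₂ → K) (r : Fin n → Fin n₂ → K)
    (T : Finset (Fin n)) (i : Fin n) :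
    block (e + ∑ j ∈ T, Z.blockVec j (r j)) i = block e i + if i ∈ T then r i else 0 := by
  funext q
  simp only [block, Pi.add_apply, Finset.sum_apply, blockVec]
  congr 1
  rw [Finset.sum_ite_eq]
  split_ifs <;> rfl

theorem block_add_sum_univ_blockVec (e : Fin n × Fin n₂ → K) (r : Fin n → Fin n₂ → K)
    (i : Fin n) : block (e + ∑ j, Z.blockVec j (r j)) i = block e i + r i := by
  rw [block_add_sum_blockVec, if_pos (Finset.mem_univ i)]

/-- Corrections already made affect other blocks only, so every block is decoded from its original
syndrome. -/
theorem sim_innerStage (est : (Fin s → Bool) → Timed (Fin n₂ → K)) (e : Fin n × Fin n₂ → K) :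
    sim χ (Z.innerStage est χ) e =
      ((), e + ∑ i, Z.blockVec i (est (syndrome Z.gen (block e i))).val) := by
  rw [innerStage, sim_bind, sim_collect _ e (fun _ => ())
    fun i => Z.blockVec i (est (syndrome Z.gen (block e i))).val]
  · rfl
  · intro i T hi
    rw [sim_bind, sim_collect_of_eq _ _ (syndrome Z.gen (block e i)), sim_bind, sim_classical,
      sim_applyBlock]
    intro j
    rw [sim_syndromeBit, traceInner_blockVec,
      Z.block_add_sum_blockVec e (fun i => (est (syndrome Z.gen (block e i))).val), if_neg hi,
      add_zero, traceInner_comm]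
    rfl

/-- The measured bits are the coordinates of the syndrome, and summing the corresponding basis
vectors rebuilds it. -/
theorem sim_outerSyndrome (x : K) (e : Fin n × Fin n₂ → K) (σ : ℕ → F)
    (h : ∀ (l : Fin k) j, traceInner (Z.outerGen x l j) e =
      algebraMap (ZMod 2) K (Z.b.repr (σ l) j)) :
    sim χ (Z.outerSyndrome x χ) e = (fun l => if l < k then σ l else 0, e) := by
  rw [outerSyndrome, sim_bind, sim_collect_of_eq _ _ fun l : Fin k => σ l]
  · rw [sim_pure]
    simp only [dite_eq_ite]
  · intro l
    rw [sim_bind, sim_collect_of_eq _ _ fun j => decide (traceInner (Z.outerGen x l j) e ≠ 0)]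
    · rw [sim_classical]
      congr 1
      simp only [Timed.val_loop, Timed.val_fop, decide_eq_true_eq]
      rw [show (fun (acc : F) (j : Fin m) => if traceInner (Z.outerGen x l j) e ≠ 0 then
        acc + Z.b j else acc) = fun acc j => acc + Z.b.repr (σ l) j • Z.b j from ?_,
        foldl_finRange_add, Module.Basis.sum_repr]
      funext acc j
      rw [h]
      rcases zmod_two_cases (Z.b.repr (σ l) j) with h0 | h0 <;> simp [h0]
    · intro j
      rw [sim_syndromeBit]

theorem encodeSymbol_val (x y : Fin m → ZMod 2) :
    (Z.encodeSymbol x y).val = Z.ρ fun j => x j • Z.ω + y j • Z.ω ^ 2 := by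
  have h1 : (fun j => x j • Z.ω + y j • Z.ω ^ 2 : Fin m → K) =
      ∑ j, (x j • (Pi.single j Z.ω : Fin m → K) + y j • (Pi.single j (Z.ω ^ 2) : Fin m → K)) := by
    funext j
    simp [Finset.sum_apply, Pi.single_apply, Finset.sum_add_distrib]
  rw [h1, map_sum]
  funext q
  simp only [encodeSymbol, Timed.val_fill, Timed.val_loop, Timed.val_bind, Timed.val_op, add_assoc]
  rw [foldl_finRange_add, Finset.sum_apply]
  refine Finset.sum_congr rfl fun j _ => ?_
  rw [map_add, ZMod.map_smul, ZMod.map_smul]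
  rfl

/-- Outer decoding corrects errors on up to `k / 2` of the encoded blocks. -/
theorem sim_outerStage_mem [DecidableEq F] {c : Fin n × Fin n₂ → K}
    (hc : ∀ i, block c i ∈ traceDual (Z.C₂ : Set (Fin n₂ → K)))
    (hA : ∀ A : Finset (Fin n), (∀ i ∈ A, block c i ∉ Z.C₂) → 2 * A.card ≤ k) :
    (sim χ (Z.outerStage χ) c).2 ∈ Z.stabilizer := by
  obtain ⟨x, y, h⟩ := Z.exists_coordinates hc
  have hbm : ∀ x : Fin n → Fin m → ZMod 2, (∀ i, Z.symbols x i ≠ 0 → block c i ∉ Z.C₂) →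
      (bmDecode (m ^ 2) k n Z.α fun l => if l < k then
        ∑ i, Z.symbols x i * Z.α ^ ((i : ℕ) * (l + 1)) else 0).val = Z.symbols x := by
    intro x hx
    refine bmDecode_val Z.α_primitive Z.n_pos (fun r hr => by rw [if_pos hr]) (hA _ fun i hi => ?_)
    exact hx i (Finset.mem_filter.1 hi).2
  have hX := hbm x fun i hi => symbols_support_subset h (Or.inl hi)
  have hY := hbm y fun i hi => symbols_support_subset h (Or.inr hi)
  -- The ω-generators supply the power sums of y, the ω̄-generators those of x.
  rw [outerStage, sim_bind, Z.sim_outerSyndrome _ _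
      (fun l => ∑ i, Z.symbols y i * Z.α ^ ((i : ℕ) * (l + 1))) (traceInner_outerGen_omega h), sim_bind,
    Z.sim_outerSyndrome _ _ (fun l => ∑ i, Z.symbols x i * Z.α ^ ((i : ℕ) * (l + 1)))
      (traceInner_outerGen_omega_sq h), sim_bind, sim_classical, sim_bind,
    sim_classical, hX, hY, sim_bind, sim_collect _ c (fun _ => ())
      fun i => Z.blockVec i (Z.ρ fun j => x i j • Z.ω + y i j • Z.ω ^ 2)]
  · rw [sim_pure]
    refine Z.mem_stabilizer_of_block_mem fun i => ?_
    rw [Z.block_add_sum_univ_blockVec c fun i => Z.ρ fun j => x i j • Z.ω + y i j • Z.ω ^ 2]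
    obtain ⟨u, hu, hb⟩ := h i
    -- In characteristic 2 the correction cancels the ρ-part of the block; an element of C₂ remains.
    rw [hb, add_right_comm,
      show ∀ v : Fin n₂ → K, v + v = 0 from fun v => funext fun q => add_self_of_algebra (v q),
      zero_add]
    exact hu
  · intro i T _
    rw [sim_bind, sim_classical, sim_bind, sim_classical, sim_bind, sim_classical,
      sim_applyBlock, encodeSymbol_val]
    simp only [Timed.val_fop, repr_symbols]

/-- Pairings are bits, so equal syndromes add up to zero on the generators, and by additivity on all
of C₂. -/
theorem mem_traceDual_of_syndrome_eq {e r : Fin n₂ → K}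
    (h : syndrome Z.gen r = syndrome Z.gen e) : e + r ∈ traceDual (Z.C₂ : Set (Fin n₂ → K)) := by
  intro v hv
  induction hv using AddSubgroup.closure_induction with
  | mem v hv =>
    obtain ⟨j, rfl⟩ := hv
    have hj := congrFun h j
    simp only [syndrome] at hj
    rw [traceInner_add_left]
    rcases traceInner_eq_zero_or_one Z.card_K Z.ω_sq e (Z.gen j) with h1 | h1 <;>
      rcases traceInner_eq_zero_or_one Z.card_K Z.ω_sq r (Z.gen j) with h2 | h2 <;>
      simp_all [add_self_of_algebra]
  | zero => exact traceInner_zero_right _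
  | add u v _ _ hu hv => rw [traceInner_add_right, hu, hv, add_zero]
  | neg v _ hv =>
    rw [show -v = v from funext fun q => neg_eq_of_add_eq_zero_left (add_self_of_algebra (v q))]
    exact hv

omit [Algebra (ZMod 2) K] in
theorem _root_.QZ.hammingNorm_add_le {ι : Type} [Fintype ι] (u v : ι → K) :
    hammingNorm (u + v) ≤ hammingNorm u + hammingNorm v := by
  classical
  refine (Finset.card_le_card ?_).trans (Finset.card_union_le _ _)
  intro i hi
  simp only [Finset.mem_filter, Finset.mem_univ, true_and, Finset.mem_union, Pi.add_apply] at hi ⊢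
  by_contra! hcon
  exact hi (by rw [hcon.1, hcon.2, add_zero])

/-- After inner decoding of an error of weight at most `δ N / 4`, at most `k / 2` blocks are
wrong. -/
theorem two_mul_card_le_of_inner {e : Fin n × Fin n₂ → K} {r : Fin n → Fin n₂ → K}
    (hr : ∀ i, syndrome Z.gen (r i) = syndrome Z.gen (block e i) ∧
      hammingNorm (r i) ≤ hammingNorm (block e i))
    (he : (hammingNorm e : ℝ) ≤ Z.δ * Z.numQubits / 4) (A : Finset (Fin n))
    (hA : ∀ i ∈ A, block e i + r i ∉ Z.C₂) : 2 * A.card ≤ k := by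
  rw [δ_mul_numQubits] at he
  -- The residual of a wrong block weighs at least δ₂n₂ and at most twice its error, as the search
  -- returns nothing heavier than that error.
  have h1 : A.card * (Z.δ₂ * n₂ / 2) ≤ hammingNorm e := by
    refine mul_card_le_hammingNorm fun i hi => ?_
    have h2 := Z.inner_dist _ (Z.mem_traceDual_of_syndrome_eq (hr i).1) (hA i hi)
    have h3 : hammingNorm (block e i + r i) ≤ 2 * hammingNorm (block e i) := by
      have := hammingNorm_add_le (block e i) (r i)
      have := (hr i).2
      omega
    have h4 : (hammingNorm (block e i + r i) : ℝ) ≤ 2 * hammingNorm (block e i) := by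
      exact_mod_cast h3
    linarith
  -- If δ₂n₂ ≤ 0 one cannot divide by it, but then the weight bound forces e = 0 and no block is
  -- wrong.
  rcases le_or_gt (Z.δ₂ * n₂) 0 with h0 | h0
  · have h2 : hammingNorm e = 0 := by
      have h3 : (k : ℝ) * (Z.δ₂ * n₂) ≤ 0 := mul_nonpos_of_nonneg_of_nonpos (by positivity) h0
      have h4 : (hammingNorm e : ℝ) ≤ 0 := by linarith
      exact_mod_cast le_antisymm h4 (by positivity)
    have hAe : A = ∅ := by
      refine Finset.eq_empty_of_forall_notMem fun i hi => hA i hi ?_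
      have h5 : block e i = 0 := by
        rw [hammingNorm_eq_zero.1 h2]; rfl
      have h6 : r i = 0 := by
        have := (hr i).2
        rw [h5, hammingNorm_zero] at this
        exact hammingNorm_eq_zero.1 (Nat.le_zero.1 this)
      rw [h5, h6, add_zero]
      exact Z.C₂.zero_mem
    simp [hAe]
  · have h2 : (A.card : ℝ) * 2 * (Z.δ₂ * n₂) ≤ k * (Z.δ₂ * n₂) := by linarith
    have h3 := le_of_mul_le_mul_right h2 h0
    have h4 : A.card * 2 ≤ k := by exact_mod_cast h3
    omega

/-- The decoder corrects up to `δ N / 4` errors if the inner blocks are decoded to vectors of least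
weight. -/
theorem corrects_decoder [DecidableEq F] {est : (Fin s → Bool) → Timed (Fin n₂ → K)}
    (hest : ∀ e, syndrome Z.gen (est (syndrome Z.gen e)).val = syndrome Z.gen e ∧
      hammingNorm (est (syndrome Z.gen e)).val ≤ hammingNorm e) :
    Z.Corrects (Z.decoder est) (Z.δ * Z.numQubits / 4) := by
  intro χ ψ hψ E hE B hB
  have h := endsIn_span_of_sim Z.card_K Z.ω_sq hψ (Z.measuresIn_decoder est (χ := χ)) (by
    intro e he
    rw [decoder, sim_bind, sim_innerStage]
    refine Z.sim_outerStage_mem (fun i => ?_) fun A hA => ?_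
    · rw [Z.block_add_sum_univ_blockVec e fun i => (est (syndrome Z.gen (block e i))).val]
      exact Z.mem_traceDual_of_syndrome_eq (hest _).1
    · refine Z.two_mul_card_le_of_inner (fun i => hest (block e i)) he A fun i hi => ?_
      rw [← Z.block_add_sum_univ_blockVec e fun i => (est (syndrome Z.gen (block e i))).val]
      exact hA i hi) hE B hB
  obtain ⟨z, hz⟩ := Submodule.mem_span_singleton.1 h
  exact ⟨z, hz.symm⟩

theorem corrects_searchDecoder [DecidableEq F] : Z.Corrects Z.searchDecoder (Z.δ * Z.numQubits / 4) :=
  Z.corrects_decoder (exhaustiveSearch_val (eq_zero_or_one_or_omega Z.card_K Z.ω_sq) Z.gen)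

theorem corrects_tableDecoder [DecidableEq F] : Z.Corrects Z.tableDecoder (Z.δ * Z.numQubits / 4) :=
  Z.corrects_decoder (exhaustiveSearch_val (eq_zero_or_one_or_omega Z.card_K Z.ω_sq) Z.gen)

end ZyablovCode

end QZ
namespace QZ

/-! ## Step counts of classical computations -/

namespace Timed

variable {α β F : Type}

@[simp] theorem steps_bind (x : Timed α) (f : α → Timed β) :
    (x >>= f).steps = x.steps + (f x.val).steps := rfl

@[simp] theorem steps_pure (a : α) : (pure a : Timed α).steps = 0 := rfl

@[simp] theorem steps_op (a : α) : (op a).steps = 1 := rfl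

@[simp] theorem steps_fop (w : ℕ) (a : α) : (fop w a).steps = w := rfl

theorem steps_ite_le (c : Prop) [Decidable c] {x y : Timed α} {A : ℕ} (hx : x.steps ≤ A)
    (hy : y.steps ≤ A) : (if c then x else y).steps ≤ A := by
  split_ifs <;> assumption

theorem val_ite_of {P : α → Prop} (c : Prop) [Decidable c] {x y : Timed α} (hx : P x.val)
    (hy : P y.val) : P (if c then x else y).val := by
  split_ifs <;> assumption

theorem steps_loop_le (body : α → β → Timed α) (l : List β) (a : α) {A : ℕ}
    (h : ∀ a, ∀ x ∈ l, (body a x).steps ≤ A) : (loop body l a).steps ≤ l.length * (A + 1) := by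
  induction l generalizing a with
  | nil => simp [loop]
  | cons x xs ih =>
    have h1 := h a x (by simp)
    have h2 := ih (body a x).val fun a y hy => h a y (by simp [hy])
    simp only [loop, List.length_cons]
    rw [Nat.add_mul]
    omega

theorem steps_loop_append (body : α → β → Timed α) (l₁ l₂ : List β) (a : α) :
    (loop body (l₁ ++ l₂) a).steps =
      (loop body l₁ a).steps + (loop body l₂ (loop body l₁ a).val).steps := by
  induction l₁ generalizing a with
  | nil => simp [loop]
  | cons x xs ih =>
    simp only [List.cons_append, loop, ih]
    omega

/-- The invariant is needed because a Berlekamp–Massey round costs time proportional to the current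
register length. -/
theorem steps_loop_range_le (body : α → ℕ → Timed α) (P : ℕ → α → Prop) (len : ℕ) (a : α) {A : ℕ}
    (h0 : P 0 a) (hstep : ∀ r < len, ∀ a, P r a → P (r + 1) (body a r).val)
    (h : ∀ r < len, ∀ a, P r a → (body a r).steps ≤ A) :
    (loop body (List.range len) a).steps ≤ len * (A + 1) := by
  induction len with
  | zero => simp [loop]
  | succ l ih =>
    have h1 := ih (fun r hr => hstep r (hr.trans (Nat.lt_succ_self l)))
      fun r hr => h r (hr.trans (Nat.lt_succ_self l))
    have h2 := h l (Nat.lt_succ_self l) _ (loop_range_invariant body P l a h0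
      fun r hr => hstep r (hr.trans (Nat.lt_succ_self l)))
    rw [List.range_succ, steps_loop_append, Nat.add_mul]
    simp only [loop]
    omega

theorem steps_fill_le {len : ℕ} (f : Fin len → Timed α) {A : ℕ} (h : ∀ i, (f i).steps ≤ A) :
    (fill f).steps ≤ len * (A + 1) := by
  change ∑ i, ((f i).steps + 1) ≤ _
  refine (Finset.sum_le_sum (g := fun _ => A + 1) fun i _ => Nat.succ_le_succ (h i)).trans ?_
  simp

theorem steps_fillPoly_le [Zero F] (len : ℕ) (f : ℕ → Timed F) {A : ℕ}
    (h : ∀ i < len, (f i).steps ≤ A) : (fillPoly len f).steps ≤ len * (A + 1) := by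
  refine (Finset.sum_le_sum (g := fun _ => A + 1) fun i hi =>
    Nat.succ_le_succ (h i (Finset.mem_range.1 hi))).trans ?_
  simp

variable [Field F]

theorem steps_fsum_le (w len : ℕ) (f : ℕ → Timed F) {A : ℕ} (h : ∀ i < len, (f i).steps ≤ A) :
    (fsum w len f).steps ≤ len * (A + w + 1) := by
  refine (steps_loop_le _ _ _ (A := A + w) fun a x hx => ?_).trans (by rw [List.length_range])
  simpa using h x (List.mem_range.1 hx)

theorem steps_fpow_le (w : ℕ) (x : F) (e : ℕ) : (fpow w x e).steps ≤ e * (w + 1) :=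
  (steps_loop_le _ _ _ (A := w) fun _ _ _ => le_rfl).trans (by rw [List.length_range])

theorem steps_horner_le (w len : ℕ) (c : ℕ → F) (x : F) :
    (horner w len c x).steps ≤ len * (2 * w + 1) :=
  (steps_loop_le _ _ _ (A := 2 * w) fun _ _ _ => by simp; omega).trans
    (by rw [List.length_range])

end Timed

section BerlekampMassey

open Timed

variable {F : Type} [Field F] [DecidableEq F]

/-- Holds for arbitrary syndromes, including those that come from no correctable error; the time
bound has to cover these. -/
theorem bmStep_len_le (w k : ℕ) (S : ℕ → F) (st : BMState F) (r : ℕ) (h : st.len ≤ r) :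
    (bmStep w k S st r).val.len ≤ r + 1 := by
  unfold bmStep
  refine val_ite_of (P := fun st : BMState F => st.len ≤ r + 1) _ ?_
    (val_ite_of (P := fun st : BMState F => st.len ≤ r + 1) _ ?_ ?_)
  · exact h.trans (Nat.le_succ r)
  · exact Nat.sub_le _ _
  · exact h.trans (Nat.le_succ r)

theorem bmStep_steps_le (w k : ℕ) (S : ℕ → F) (st : BMState F) (r : ℕ) (h : st.len ≤ k) :
    (bmStep w k S st r).steps ≤ (k + 1) * (7 * w + 5) := by
  have h1 : (fsum w (st.len + 1) fun i => fop w (st.conn i * S (r - i))).steps ≤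
      (k + 1) * (w + w + 1) :=
    (steps_fsum_le w _ _ (A := w) fun i _ => le_rfl).trans (Nat.mul_le_mul_right _ (Nat.succ_le_succ h))
  have h2 : ∀ q : F, (fillPoly (k + 1) (fun i => do
      let inRange ← op (decide (st.shift ≤ i))
      if inRange then
        let t ← fop w (q * st.prev (i - st.shift))
        fop w (st.conn i - t)
      else
        return st.conn i)).steps ≤ (k + 1) * (1 + (w + w) + 1) := by
    intro q
    refine steps_fillPoly_le _ _ fun i _ => ?_
    rw [steps_bind, steps_op]
    exact Nat.add_le_add_left (steps_ite_le _ (by simp) (by simp)) _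
  have h3 : (bmStep w k S st r).steps ≤ (k + 1) * (w + w + 1) +
      (w + (w + (w + ((k + 1) * (1 + (w + w) + 1) + (1 + 1))))) := by
    unfold bmStep
    refine Nat.add_le_add h1 (Nat.add_le_add le_rfl (steps_ite_le _ ?_ ?_))
    · simp only [steps_bind, steps_op, steps_pure]; omega
    · refine Nat.add_le_add le_rfl (Nat.add_le_add le_rfl (Nat.add_le_add (h2 _)
        (Nat.add_le_add le_rfl (steps_ite_le _ (by simp) (by simp)))))
  nlinarith

theorem bmLocator_steps_le (w k : ℕ) (S : ℕ → F) :
    (bmLocator w k S).steps ≤ k * ((k + 1) * (7 * w + 5) + 1) := by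
  unfold bmLocator
  rw [steps_bind, steps_pure, add_zero]
  exact steps_loop_range_le _ (fun r st => st.len ≤ r) k _ le_rfl
    (fun r _ st h => bmStep_len_le w k S st r h)
    (fun r hr st h => bmStep_steps_le w k S st r (h.trans hr.le))

theorem bmDecode_steps_le {w k n : ℕ} (α : F) (S : ℕ → F) (hw : 1 ≤ w) (hk : k + 1 ≤ n) :
    (bmDecode w k n α S).steps ≤ 36 * (n ^ 2 * w) := by
  have h1 := bmLocator_steps_le w k S
  have h2 : ∀ loc : ℕ → F, (fillPoly k (fun t => fsum w (t + 1)
      (fun i => fop w (S i * loc (t - i))))).steps ≤ k * (k * (w + w + 1) + 1) := fun loc =>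
    steps_fillPoly_le _ _ fun t ht => (steps_fsum_le w _ _ (A := w) fun i _ => le_rfl).trans
      (Nat.mul_le_mul_right _ ht)
  have h3 : ∀ loc : ℕ → F, (fillPoly k (fun t =>
      fop w (((t + 1 : ℕ) : F) * loc (t + 1)))).steps ≤ k * (w + 1) := fun loc =>
    steps_fillPoly_le _ _ fun t _ => le_rfl
  have h4 : (bmDecode w k n α S).steps ≤ k * ((k + 1) * (7 * w + 5) + 1) +
      (k * (k * (w + w + 1) + 1) + (k * (w + 1) + (w + n * ((n * (w + 1) +
        ((k + 1) * (2 * w + 1) + (w + (k * (2 * w + 1) + (k * (2 * w + 1) +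
          (w + (w + w))))))) + 1)))) := by
    unfold bmDecode
    refine Nat.add_le_add h1 (Nat.add_le_add (h2 _) (Nat.add_le_add (h3 _)
      (Nat.add_le_add le_rfl (steps_fill_le _ fun i => ?_))))
    refine Nat.add_le_add ((steps_fpow_le _ _ _).trans (Nat.mul_le_mul_right _ i.2.le))
      (Nat.add_le_add (steps_horner_le _ _ _ _) (Nat.add_le_add le_rfl (steps_ite_le _ ?_ ?_)))
    · exact Nat.add_le_add (steps_horner_le _ _ _ _) (Nat.add_le_add (steps_horner_le _ _ _ _) le_rfl)
    · exact Nat.zero_le _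
  have hw1 : w + 1 ≤ 2 * w := by omega
  have hw2 : 2 * w + 1 ≤ 3 * w := by omega
  have hkn : k ≤ n := by omega
  have hn : 1 ≤ n := by omega
  have e1 : w ≤ n * w := Nat.le_mul_of_pos_left w hn
  have e2 : n * w ≤ n * (n * w) := Nat.le_mul_of_pos_left _ hn
  have e3 : n ≤ n * (n * w) := by nlinarith
  have b1 : k * ((k + 1) * (7 * w + 5) + 1) ≤ n * (n * (12 * w) + 1) := by
    gcongr; omega
  have b2 : k * (k * (w + w + 1) + 1) ≤ n * (n * (3 * w) + 1) := by
    gcongr; omega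
  have b3 : k * (w + 1) ≤ n * (2 * w) := by gcongr
  have b4 : n * ((n * (w + 1) + ((k + 1) * (2 * w + 1) + (w + (k * (2 * w + 1) +
      (k * (2 * w + 1) + (w + (w + w))))))) + 1) ≤
      n * ((n * (2 * w) + (n * (3 * w) + (w + (n * (3 * w) + (n * (3 * w) + (w + (w + w))))))) + 1)
      := by gcongr
  have e4 : n * ((n * (2 * w) + (n * (3 * w) + (w + (n * (3 * w) + (n * (3 * w) +
      (w + (w + w))))))) + 1) = 11 * (n * (n * w)) + 4 * (n * w) + n := by ring
  have e5 : n * (n * (12 * w) + 1) = 12 * (n * (n * w)) + n := by ring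
  have e6 : n * (n * (3 * w) + 1) = 3 * (n * (n * w)) + n := by ring
  have e7 : n * (2 * w) = 2 * (n * w) := by ring
  have e8 : n ^ 2 * w = n * (n * w) := by ring
  rw [e8]
  -- The constant is 36 = 26 + 6 + 3 + 1: the coefficients of n²w, nw, n and w, with every term
  -- absorbed into n²w.
  omega

end BerlekampMassey

section Exhaustive

open Timed

variable {K : Type} [Field K] [DecidableEq K]

omit [DecidableEq K] in
theorem length_allVectors (ω : K) (l : ℕ) : (allVectors ω l).length = 4 ^ l := by
  induction l with
  | zero => rfl
  | succ l ih =>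
    simp only [allVectors, List.flatMap_cons, List.flatMap_nil, List.length_append,
      List.length_map, List.length_nil, ih]
    ring

theorem innerBit_steps_le {l : ℕ} (u v : Fin l → K) : (innerBit u v).steps ≤ 3 * l + 1 := by
  unfold innerBit
  rw [steps_bind, steps_op]
  refine Nat.add_le_add_right ((steps_loop_le _ _ _ (A := 2) fun a x _ => ?_).trans ?_) 1
  · simp
  · rw [List.length_finRange]; omega

theorem weightOf_steps_le {l : ℕ} (u : Fin l → K) : (weightOf u).steps ≤ 3 * l := by
  unfold weightOf
  refine (steps_loop_le _ _ _ (A := 2) fun a x _ => ?_).trans ?_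
  · exact Nat.add_le_add (le_refl 1) (steps_ite_le _ (Nat.zero_le _) le_rfl)
  · rw [List.length_finRange]; omega

theorem bitsEqual_steps_le {s : ℕ} (a c : Fin s → Bool) : (bitsEqual a c).steps ≤ 2 * s := by
  unfold bitsEqual
  refine (steps_loop_le _ _ _ (A := 1) fun a x _ => ?_).trans ?_
  · simp
  · rw [List.length_finRange]; omega

/-- Each of the 4^l candidates costs s inner products of length l ≥ s, plus linear work. -/
theorem exhaustiveSearch_steps_le (ω : K) {l s : ℕ} (g : Fin s → Fin l → K) (σ : Fin s → Bool)
    (hs : s ≤ l) (hl : 1 ≤ l) : (exhaustiveSearch ω g σ).steps ≤ 15 * (l ^ 2 * 4 ^ l) := by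
  have hsl : s * l ≤ l * l := Nat.mul_le_mul_right l hs
  have hll : l ≤ l * l := Nat.le_mul_of_pos_left l hl
  have hpos : 1 ≤ 4 ^ l := Nat.one_le_pow _ _ (by norm_num)
  have hbody : (exhaustiveSearch ω g σ).steps ≤ 4 ^ l * (l * (1 + 1) + (s * (3 * l + 1 + 1) +
      (2 * s + (3 * l + 1))) + 1) + 1 := by
    unfold exhaustiveSearch
    refine Nat.add_le_add ((steps_loop_le _ _ _ fun best e _ => ?_).trans
      (by rw [length_allVectors])) ?_
    · refine Nat.add_le_add (steps_fill_le _ fun i => le_rfl) (Nat.add_le_add (steps_fill_le _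
        fun i => innerBit_steps_le _ _) (Nat.add_le_add (bitsEqual_steps_le _ _)
        (steps_ite_le _ (Nat.add_le_add (weightOf_steps_le _) ?_) (Nat.zero_le _))))
      rcases best with _ | ⟨_, _⟩ <;> exact le_rfl
    · rcases (loop _ (allVectors ω l) none).val with _ | ⟨_, _⟩ <;> exact le_rfl
  have h1 : l * (1 + 1) + (s * (3 * l + 1 + 1) + (2 * s + (3 * l + 1))) + 1 ≤ 14 * l ^ 2 := by
    have : s * (3 * l + 1 + 1) = 3 * (s * l) + 2 * s := by ring
    have : l ^ 2 = l * l := sq l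
    omega
  have h2 := Nat.mul_le_mul_left (4 ^ l) h1
  have h3 : 1 * 1 ≤ l ^ 2 * 4 ^ l := Nat.mul_le_mul (Nat.one_le_pow _ _ hl) hpos
  have h4 : 4 ^ l * (14 * l ^ 2) = 14 * (l ^ 2 * 4 ^ l) := by ring
  omega

theorem buildTable_steps_le (ω : K) {l s : ℕ} (g : Fin s → Fin l → K) (hs : s ≤ l) (hl : 1 ≤ l) :
    (buildTable ω g).steps ≤ 17 * (l ^ 2 * 4 ^ l * 4 ^ l) := by
  have h : ∀ σ, (exhaustiveSearch ω g σ).steps + s + l ≤ 17 * (l ^ 2 * 4 ^ l) := by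
    intro σ
    have h1 := exhaustiveSearch_steps_le ω g σ hs hl
    have h2 : l ≤ l ^ 2 * 4 ^ l := by
      calc l = l * 1 := (mul_one l).symm
        _ ≤ l ^ 2 * 4 ^ l := Nat.mul_le_mul (by nlinarith) (Nat.one_le_pow _ _ (by norm_num))
    omega
  calc (buildTable ω g).steps ≤ ∑ σ : Fin s → Bool, 17 * (l ^ 2 * 4 ^ l) :=
        Finset.sum_le_sum fun σ _ => h σ
    _ = 2 ^ s * (17 * (l ^ 2 * 4 ^ l)) := by simp
    _ ≤ 4 ^ l * (17 * (l ^ 2 * 4 ^ l)) := by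
        refine Nat.mul_le_mul_right _ ?_
        calc 2 ^ s ≤ 2 ^ l := Nat.pow_le_pow_right (by norm_num) hs
          _ ≤ 4 ^ l := Nat.pow_le_pow_left (by norm_num) l
    _ = 17 * (l ^ 2 * 4 ^ l * 4 ^ l) := by ring

end Exhaustive

/-! ## Step counts of programs -/

namespace QProg

variable {K ι α β : Type} [Field K] [DecidableEq K] [Fintype ι]

/-- The number of steps of the longest branch of a program. -/
def maxSteps : QProg K ι α → ℕ
  | ret _ => 0
  | work c p => maxSteps p + c
  | gate _ _ p => maxSteps p + 1
  | measure g next =>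
    max (maxSteps (next false)) (maxSteps (next true)) + (hammingNorm g + 4)

/-- The bound does not mention the state, so it covers every input and even outcomes of probability
zero. -/
theorem steps_le_maxSteps [DecidableEq ι] {ω : K} (p : QProg K ι α) (φ : State ι) :
    ∀ B ∈ run ω p φ, B.steps ≤ maxSteps p := by
  induction p generalizing φ with
  | ret a => simp [run]
  | work c p ih =>
    intro B hB
    obtain ⟨B', hB', rfl⟩ := List.mem_map.1 hB
    exact Nat.add_le_add_right (ih φ B' hB') c
  | gate q x p ih =>
    intro B hB
    obtain ⟨B', hB', rfl⟩ := List.mem_map.1 hB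
    exact Nat.add_le_add_right (ih _ B' hB') 1
  | measure g next ih =>
    intro B hB
    obtain ⟨B', hB', rfl⟩ := List.mem_map.1 hB
    obtain ⟨o, -, hB''⟩ := List.mem_flatMap.1 hB'
    refine Nat.add_le_add_right ((ih o _ B' hB'').trans ?_) _
    cases o
    · exact le_max_left _ _
    · exact le_max_right _ _

theorem maxSteps_bind_le {p : QProg K ι α} {f : α → QProg K ι β} {A B : ℕ} (hp : maxSteps p ≤ A)
    (hf : ∀ a, maxSteps (f a) ≤ B) : maxSteps (p >>= f) ≤ A + B := by
  suffices h : maxSteps (seq f p) ≤ maxSteps p + B from h.trans (Nat.add_le_add_right hp B)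
  clear hp
  induction p with
  | ret a => simpa [seq, maxSteps] using hf a
  | work c p ih => simp only [seq, maxSteps]; omega
  | gate q x p ih => simp only [seq, maxSteps]; omega
  | measure g next ih =>
    have h1 := ih false
    have h2 := ih true
    simp only [seq, maxSteps]
    omega

theorem maxSteps_classical_le {t : Timed α} {A : ℕ} (h : t.steps ≤ A) :
    maxSteps (classical t : QProg K ι α) ≤ A := by
  simpa [classical, maxSteps] using h

theorem maxSteps_syndromeBit (χ : (ι → K) → Bool) (g : ι → K) :
    maxSteps (syndromeBit χ g) = hammingNorm g + 5 := by
  simp only [syndromeBit, maxSteps, max_self]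
  omega

theorem maxSteps_collect_le {len : ℕ} {p : Fin len → QProg K ι α} {A : ℕ}
    (h : ∀ i, maxSteps (p i) ≤ A) : maxSteps (collect p) ≤ len * (A + 1) := by
  induction len with
  | zero => simp [collect, maxSteps]
  | succ l ih =>
    have := maxSteps_bind_le (f := fun a => collect (fun i => p i.succ) >>= fun as =>
      work 1 (ret (Fin.cons a as : Fin (l + 1) → α))) (h 0)
      fun a => maxSteps_bind_le (ih fun i => h i.succ) (B := 1) fun as => by simp [maxSteps]
    refine this.trans ?_
    rw [Nat.add_mul]
    omega

end QProg

/-! ### Step bounds for the two stages of the decoder and for the table -/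

namespace ZyablovCode

open QProg

variable {K F : Type} [Field K] [DecidableEq K] [Algebra (ZMod 2) K]
  [Field F] [Algebra (ZMod 2) F] {m n k n₂ s : ℕ}

theorem two_le_n₂ (Z : ZyablovCode K F m n k n₂ s) : 2 ≤ n₂ := by
  have := Z.inner_length_eq
  have := Z.two_le_m
  omega

theorem m_le_n₂ (Z : ZyablovCode K F m n k n₂ s) : m ≤ n₂ := by
  have := Z.inner_length_eq
  omega

theorem s_le_n₂ (Z : ZyablovCode K F m n k n₂ s) : s ≤ n₂ := by
  have := Z.inner_length_eq
  omega

theorem m_le_n (Z : ZyablovCode K F m n k n₂ s) : m ≤ n := by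
  have h1 := Z.length_eq
  have h2 : m < 2 ^ m := Nat.lt_two_pow_self
  omega

variable (Z : ZyablovCode K F m n k n₂ s) {χ : (Fin n × Fin n₂ → K) → Bool}

theorem maxSteps_applyBlock_le (i : Fin n) (u : Fin n₂ → K) :
    maxSteps (Z.applyBlock i u) ≤ 2 * n₂ := by
  unfold applyBlock
  refine (maxSteps_bind_le (A := n₂ * (1 + 1)) (B := 0)
    (maxSteps_collect_le fun q => le_rfl) fun _ => le_rfl).trans (by omega)

theorem hammingNorm_blockVec_le (i : Fin n) (u : Fin n₂ → K) :
    hammingNorm (Z.blockVec i u) ≤ n₂ := by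
  rw [hammingNorm_eq_sum_block, Finset.sum_eq_single i]
  · exact (Finset.card_le_univ _).trans (by simp)
  · intro j _ hj
    rw [block_blockVec, if_neg hj, hammingNorm_zero]
  · exact fun h => absurd (Finset.mem_univ i) h

theorem maxSteps_innerStage_le {est : (Fin s → Bool) → Timed (Fin n₂ → K)} {A : ℕ}
    (hA : ∀ σ, (est σ).steps ≤ A) :
    maxSteps (Z.innerStage est χ) ≤ n * (10 * n₂ ^ 2 + A) := by
  have h1 : maxSteps (Z.innerStage est χ) ≤
      n * ((s * (n₂ + 5 + 1) + (A + 2 * n₂)) + 1) + 0 := by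
    unfold innerStage
    refine maxSteps_bind_le (maxSteps_collect_le fun i => maxSteps_bind_le
      (maxSteps_collect_le fun j => ?_) fun σ => maxSteps_bind_le
        (maxSteps_classical_le (hA σ)) fun e => Z.maxSteps_applyBlock_le i e) fun _ => le_rfl
    rw [maxSteps_syndromeBit]
    exact Nat.add_le_add_right (Z.hammingNorm_blockVec_le _ _) 5
  refine h1.trans ?_
  rw [add_zero]
  refine Nat.mul_le_mul_left n ?_
  have h2 := Z.two_le_n₂
  have h3 : s * (n₂ + 5 + 1) ≤ n₂ * (n₂ + 5 + 1) := Nat.mul_le_mul_right _ Z.s_le_n₂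
  nlinarith

/-- There are km ≤ N measurements, each of weight at most N; the arithmetic in F adds about m² ≤ N
steps to each. -/
theorem maxSteps_outerSyndrome_le (x : K) :
    maxSteps (Z.outerSyndrome x χ) ≤ 10 * (n * n₂) ^ 2 := by
  have h1 : maxSteps (Z.outerSyndrome x χ) ≤
      k * ((m * (n * n₂ + 5 + 1) + m * (m ^ 2 + 1)) + 1) + 0 := by
    unfold outerSyndrome
    refine maxSteps_bind_le (maxSteps_collect_le fun l => maxSteps_bind_le
      (maxSteps_collect_le fun j => ?_) fun bits => maxSteps_classical_le
        ((Timed.steps_loop_le _ _ _ (A := m ^ 2) fun _ _ _ => le_rfl).trans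
          (by rw [List.length_finRange]))) fun _ => le_rfl
    rw [maxSteps_syndromeBit]
    refine Nat.add_le_add_right ((Finset.card_le_univ _).trans ?_) 5
    simp
  refine h1.trans ?_
  have hk : k ≤ n := by have := Z.two_mul_k_lt_n; omega
  have h2 : k * m ≤ n * n₂ := Nat.mul_le_mul hk Z.m_le_n₂
  have h3 : m * m ≤ n * n₂ := Nat.mul_le_mul Z.m_le_n Z.m_le_n₂
  have h4 : k ≤ n * n₂ := hk.trans (Nat.le_mul_of_pos_right n (by have := Z.two_le_n₂; omega))
  set N := n * n₂ with hN
  have h5 : 1 ≤ N := by have := Z.k_pos; omega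
  calc k * ((m * (N + 5 + 1) + m * (m ^ 2 + 1)) + 1) + 0
      = (k * m) * (N + 7 + m * m) + k := by ring
    _ ≤ N * (N + 7 + N) + N := by gcongr
    _ ≤ 10 * N ^ 2 := by nlinarith

theorem encodeSymbol_steps_le (x y : Fin m → ZMod 2) :
    (Z.encodeSymbol x y).steps ≤ n₂ * (m * 5 + 1) := by
  unfold encodeSymbol
  refine Timed.steps_fill_le _ fun q => (Timed.steps_loop_le _ _ _ (A := 4) fun _ _ _ => ?_).trans
    (by rw [List.length_finRange])
  simp

variable [DecidableEq F]

/-- The constant collects 10 for each syndrome half, 36 for each Berlekamp–Massey run and 11 for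
encoding and applying the corrections. -/
theorem maxSteps_outerStage_le : maxSteps (Z.outerStage χ) ≤ 103 * (n * n₂) ^ 2 := by
  have hm := Z.two_le_m
  have hk := Z.two_mul_k_lt_n
  have hk1 := Z.k_pos
  have hbm : ∀ S : ℕ → F, (bmDecode (m ^ 2) k n Z.α S).steps ≤ 36 * (n ^ 2 * m ^ 2) := fun S =>
    bmDecode_steps_le Z.α S (Nat.one_le_pow _ _ (by omega)) (by omega)
  have h1 : maxSteps (Z.outerStage χ) ≤ 10 * (n * n₂) ^ 2 + (10 * (n * n₂) ^ 2 +
      (36 * (n ^ 2 * m ^ 2) + (36 * (n ^ 2 * m ^ 2) +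
        (n * ((m ^ 2 + (m ^ 2 + (n₂ * (m * 5 + 1) + 2 * n₂))) + 1) + 0)))) := by
    unfold outerStage
    refine maxSteps_bind_le (Z.maxSteps_outerSyndrome_le _) fun SY => maxSteps_bind_le
      (Z.maxSteps_outerSyndrome_le _) fun SX => maxSteps_bind_le (maxSteps_classical_le (hbm _))
      fun X => maxSteps_bind_le (maxSteps_classical_le (hbm _)) fun Y => maxSteps_bind_le
      (maxSteps_collect_le fun i => maxSteps_bind_le (maxSteps_classical_le le_rfl) fun x =>
        maxSteps_bind_le (maxSteps_classical_le le_rfl) fun y => maxSteps_bind_le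
          (maxSteps_classical_le (Z.encodeSymbol_steps_le _ _))
          fun e => Z.maxSteps_applyBlock_le i e) fun _ => le_rfl
  have hmn := Z.m_le_n₂
  have hn2 := Z.two_le_n₂
  have h2 : n ^ 2 * m ^ 2 ≤ (n * n₂) ^ 2 := by
    rw [mul_pow]; gcongr
  have h3 : (m ^ 2 + (m ^ 2 + (n₂ * (m * 5 + 1) + 2 * n₂))) + 1 ≤ 11 * n₂ ^ 2 := by
    have h4 : m ^ 2 ≤ n₂ ^ 2 := Nat.pow_le_pow_left hmn 2
    have h5 : n₂ * (m * 5 + 1) ≤ n₂ * (n₂ * 5 + 1) := by gcongr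
    nlinarith
  have h4 : n * ((m ^ 2 + (m ^ 2 + (n₂ * (m * 5 + 1) + 2 * n₂))) + 1) ≤ 11 * (n * n₂) ^ 2 := by
    calc _ ≤ n * (11 * n₂ ^ 2) := Nat.mul_le_mul_left n h3
      _ ≤ (n * n) * (11 * n₂ ^ 2) := Nat.mul_le_mul_right _ (Nat.le_mul_of_pos_left n (by omega))
      _ = _ := by ring
  omega

theorem runsWithin_decoder {est : (Fin s → Bool) → Timed (Fin n₂ → K)} {A : ℕ}
    (hA : ∀ σ, (est σ).steps ≤ A) :
    Z.RunsWithin (Z.decoder est) (n * (10 * n₂ ^ 2 + A) + 103 * (n * n₂) ^ 2) := by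
  intro χ φ B hB
  refine (steps_le_maxSteps _ φ B hB).trans ?_
  exact maxSteps_bind_le (Z.maxSteps_innerStage_le hA) fun _ => Z.maxSteps_outerStage_le

omit [DecidableEq F] in
theorem RunsWithin.mono {Z : ZyablovCode K F m n k n₂ s}
    {dec : ((Fin n × Fin n₂ → K) → Bool) → Z.Prog Unit} {T T' : ℕ} (h : Z.RunsWithin dec T)
    (hT : T ≤ T') : Z.RunsWithin dec T' := fun χ φ B hB => (h χ φ B hB).trans hT

/-- The constant 115 = 103 + 12 is dictated by the table version, where the inner stage costs at
most 12N²; here 25 for the search term and 103 for N² would do. -/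
theorem runsWithin_searchDecoder :
    Z.RunsWithin Z.searchDecoder (115 * (n * (n₂ ^ 2 * 4 ^ n₂) + Z.numQubits ^ 2)) := by
  have hn2 := Z.two_le_n₂
  refine (Z.runsWithin_decoder fun σ => exhaustiveSearch_steps_le Z.ω Z.gen σ Z.s_le_n₂
    (by omega)).mono ?_
  have h1 : n₂ ^ 2 * 1 ≤ n₂ ^ 2 * 4 ^ n₂ :=
    Nat.mul_le_mul_left _ (Nat.one_le_pow _ _ (by norm_num))
  have h2 : n * (10 * n₂ ^ 2 + 15 * (n₂ ^ 2 * 4 ^ n₂)) ≤ n * (25 * (n₂ ^ 2 * 4 ^ n₂)) :=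
    Nat.mul_le_mul_left n (by omega)
  have h3 : n * (25 * (n₂ ^ 2 * 4 ^ n₂)) = 25 * (n * (n₂ ^ 2 * 4 ^ n₂)) := by ring
  simp only [numQubits]
  omega

theorem runsWithin_tableDecoder : Z.RunsWithin Z.tableDecoder (115 * Z.numQubits ^ 2) := by
  refine (Z.runsWithin_decoder fun σ => le_refl (s + n₂)).mono ?_
  have h1 : 10 * n₂ ^ 2 + (s + n₂) ≤ 12 * n₂ ^ 2 := by
    have := Z.s_le_n₂
    have := Z.two_le_n₂
    nlinarith
  have h2 : n * (10 * n₂ ^ 2 + (s + n₂)) ≤ 12 * (n * n₂) ^ 2 := by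
    calc _ ≤ n * (12 * n₂ ^ 2) := Nat.mul_le_mul_left n h1
      _ ≤ (n * n) * (12 * n₂ ^ 2) := Nat.mul_le_mul_right _ (Nat.le_mul_of_pos_left n Z.n_pos)
      _ = _ := by ring
  simp only [numQubits]
  omega

-- At inner rate at least r the inner length is logarithmic in the outer one: 4^n₂ = 2^(2n₂) ≤
-- 2^(qm) = (n + 1)^q, and n + 1 ≤ N as n₂ ≥ 2.
omit [DecidableEq F] in
theorem four_pow_le {r : ℝ} {q : ℕ} (hq : 2 ≤ q * r) (h : r * n₂ ≤ m) :
    4 ^ n₂ ≤ Z.numQubits ^ q := by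
  have h1 : 2 * n₂ ≤ q * m := by
    have : (2 * n₂ : ℝ) ≤ q * m := by
      calc (2 * n₂ : ℝ) ≤ q * r * n₂ := by gcongr
        _ = q * (r * n₂) := by ring
        _ ≤ q * m := by gcongr
    exact_mod_cast this
  calc 4 ^ n₂ = 2 ^ (2 * n₂) := by rw [pow_mul]; norm_num
    _ ≤ 2 ^ (q * m) := Nat.pow_le_pow_right (by norm_num) h1
    _ = (n + 1) ^ q := by rw [Z.length_eq, ← pow_mul, mul_comm]
    _ ≤ _ := by
      refine Nat.pow_le_pow_left ?_ q
      have h2 := Z.n_pos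
      have h3 := Z.two_le_n₂
      rw [numQubits]
      nlinarith

omit [DecidableEq F] in
theorem n₂_le_numQubits : n₂ ≤ Z.numQubits := Nat.le_mul_of_pos_left n₂ Z.n_pos

/-- The exponent 2q + 2 comes from the table: one factor N^q bounds the number of syndromes, another
the length of each search. The search decoder needs only q + 2, and its two terms double the
constant 115. -/
theorem polynomial_bounds {r : ℝ} {q : ℕ} (hq : 2 ≤ q * r) (h : r * n₂ ≤ m) :
    Z.RunsWithin Z.searchDecoder (230 * Z.numQubits ^ (2 * q + 2)) ∧
      (buildTable Z.ω Z.gen).steps ≤ 230 * Z.numQubits ^ (2 * q + 2) := by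
  have h1 := Z.four_pow_le hq h
  have h2 := Z.n₂_le_numQubits
  have hN : 1 ≤ Z.numQubits := by have := Z.two_le_n₂; omega
  have h3 : n * n₂ ^ 2 ≤ Z.numQubits ^ 2 := by
    rw [numQubits, mul_pow]
    exact Nat.mul_le_mul_right _ (Nat.le_self_pow two_ne_zero n)
  have h4 : n₂ ^ 2 ≤ Z.numQubits ^ 2 := Nat.pow_le_pow_left h2 2
  refine ⟨Z.runsWithin_searchDecoder.mono ?_, ?_⟩
  · have h5 : n * (n₂ ^ 2 * 4 ^ n₂) ≤ Z.numQubits ^ (2 * q + 2) := by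
      calc n * (n₂ ^ 2 * 4 ^ n₂) = (n * n₂ ^ 2) * 4 ^ n₂ := by ring
        _ ≤ Z.numQubits ^ 2 * Z.numQubits ^ q := Nat.mul_le_mul h3 h1
        _ = Z.numQubits ^ (2 + q) := (pow_add _ _ _).symm
        _ ≤ _ := Nat.pow_le_pow_right hN (by omega)
    have h6 : Z.numQubits ^ 2 ≤ Z.numQubits ^ (2 * q + 2) := Nat.pow_le_pow_right hN (by omega)
    omega
  · refine (buildTable_steps_le Z.ω Z.gen Z.s_le_n₂ (by have := Z.two_le_n₂; omega)).trans ?_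
    have h5 : n₂ ^ 2 * 4 ^ n₂ * 4 ^ n₂ ≤ Z.numQubits ^ (2 * q + 2) := by
      calc n₂ ^ 2 * 4 ^ n₂ * 4 ^ n₂
          ≤ Z.numQubits ^ 2 * Z.numQubits ^ q * Z.numQubits ^ q := by gcongr
        _ = _ := by ring
    omega

end ZyablovCode

end QZ

/-! ### The main theorem -/

theorem mainTheorem9 :
    (∀ (K F : Type) [Field K] [DecidableEq K] [Algebra (ZMod 2) K]
        [Field F] [DecidableEq F] [Algebra (ZMod 2) F] (m n k n₂ s : ℕ)
        (Z : QZ.ZyablovCode K F m n k n₂ s),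
      (∀ c ∈ QZ.traceDual Z.stabilizer, c ∉ Z.stabilizer →
        Z.δ * Z.numQubits ≤ hammingNorm c) ∧
      Z.Corrects Z.searchDecoder (Z.δ * Z.numQubits / 4) ∧
      Z.Corrects Z.tableDecoder (Z.δ * Z.numQubits / 4)) ∧
    (∃ C : ℕ, ∀ (K F : Type) [Field K] [DecidableEq K] [Algebra (ZMod 2) K]
        [Field F] [DecidableEq F] [Algebra (ZMod 2) F] (m n k n₂ s : ℕ)
        (Z : QZ.ZyablovCode K F m n k n₂ s),
      Z.RunsWithin Z.searchDecoder (C * (n * (n₂ ^ 2 * 4 ^ n₂) + Z.numQubits ^ 2)) ∧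
      Z.RunsWithin Z.tableDecoder (C * Z.numQubits ^ 2)) ∧
    (∀ r : ℝ, 0 < r → ∃ C a : ℕ, ∀ (K F : Type) [Field K] [DecidableEq K] [Algebra (ZMod 2) K]
        [Field F] [DecidableEq F] [Algebra (ZMod 2) F] (m n k n₂ s : ℕ)
        (Z : QZ.ZyablovCode K F m n k n₂ s), r * n₂ ≤ m →
      Z.RunsWithin Z.searchDecoder (C * Z.numQubits ^ a) ∧
      (QZ.buildTable Z.ω Z.gen).steps ≤ C * Z.numQubits ^ a) := by
  refine ⟨?_, ⟨115, ?_⟩, fun r hr => ?_⟩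
  · intro K F _ _ _ _ _ _ m n k n₂ s Z
    exact ⟨fun c hc hcS => Z.distance_le hc hcS, Z.corrects_searchDecoder, Z.corrects_tableDecoder⟩
  · intro K F _ _ _ _ _ _ m n k n₂ s Z
    exact ⟨Z.runsWithin_searchDecoder, Z.runsWithin_tableDecoder⟩
  -- The exponent depends on r alone, as uniformity over all codes requires.
  · obtain ⟨q, hq⟩ := exists_nat_ge (2 / r)
    refine ⟨230, 2 * q + 2, ?_⟩
    intro K F _ _ _ _ _ _ m n k n₂ s Z h
    exact Z.polynomial_bounds ((div_le_iff₀ hr).1 hq) h
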